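/- **Setting.** Let $K,M\ge 1$ be integers with $KM>1$, let $R>0$, $\sigma>0$, and let $W\in\mathbb{R}^{\mathsf R\times\mathsf C}$ be a base matrix with non-negative entries such that, for some constants $\xi_1,\xi_2>0$, $\xi_1\le \frac1{\mathsf R}\sum_{\mathsf r'}W_{\mathsf r'\mathsf c}\le\xi_2$ and $\xi_1\le \frac1{\mathsf C}\sum_{\mathsf c'}W_{\mathsf r\mathsf c'}\le\xi_2$ for all $\mathsf r\in[\mathsf R]$, $\mathsf c\in[\mathsf C]$. Let $p_k=e^{2\pi i k/K}$. State evolution is the recursion $\psi_{\mathsf c}^0=1$ and, for $t\ge 0$, $$\phi_{\mathsf r}^t=\sigma^2+\frac1{\mathsf C}\sum_{\mathsf c}W_{\mathsf r\mathsf c}\psi_{\mathsf c}^t,\qquad \tau_{\mathsf c}^t=\frac{R/2}{\ln(KM)}\Big[\frac1{\mathsf R}\sum_{\mathsf r}\frac{W_{\mathsf r\mathsf c}}{\phi_{\mathsf r}^t}\Big]^{-1},\qquad \psi_{\mathsf c}^{t+1}=1-\mathcal E(\tau_{\mathsf c}^t),$$ $$\mathcal E(\tau)=\mathbb E\left[\frac{\sum_{k=1}^K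 \Re[p_k]\,e^{\frac1\tau\Re[(1+\sqrt\tau U_1)\overline{p_k}]}}{\sum_{a=1}^K e^{\frac1\tau\Re[(1+\sqrt\tau U_1)\overline{p_a}]}+\sum_{j=2}^M\sum_{b=1}^K e^{\Re[U_j\overline{p_b}]/\sqrt\tau}}\right],$$ where $U_1,\dots,U_M$ are i.i.d. $\mathcal{CN}(0,2)$ (independent standard Gaussian real and imaginary parts). Put $\nu_{\mathsf c}^t=\frac{1}{\tau_{\mathsf c}^t\ln(KM)}$. **Statement.** For all such data, all $t\ge 0$ and all $\mathsf c$, $$\nu_{\mathsf c}^t=\frac{2}{R\,\mathsf R}\sum_{\mathsf r}\frac{W_{\mathsf r\mathsf c}}{\phi_{\mathsf r}^t},\qquad \frac2R\cdot\frac{\xi_1}{\sigma^2+2\xi_2}\le\nu_{\mathsf c}^t\le\frac2R\cdot\frac{\xi_2}{\sigma^2}.$$ Moreover, for every $K\ge 1$ and all $0<\underline\nu\le\overline\nu$ there are constants $\alpha_K,\alpha_{1K},\alpha_{2K}>0$ and $M_0$, depending only on $K,\underline\nu,\overline\nu$, and non-negative scalars $f_{K,M}=f_{K,M}(\delta)$,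 $h_{K,M}=h_{K,M}(\nu)$ such that for all $M\ge M_0$, all $\delta\in(0,\frac12)$ and all $\nu\in[\underline\nu,\overline\nu]$ $$f_{K,M}(\delta)\le\frac{(KM)^{-\alpha_{1K}\delta^2}}{\delta\sqrt{\ln(KM)}},\qquad h_{K,M}(\nu)\le\frac{(KM)^{-\alpha_{2K}\nu}}{\sqrt{\nu\ln(KM)}},$$ and such that for all $M\ge M_0$, all $W,R,\sigma,\xi_1,\xi_2$ as above with $\underline\nu=\frac2R\frac{\xi_1}{\sigma^2+2\xi_2}$ and $\overline\nu=\frac2R\frac{\xi_2}{\sigma^2}$, all $t\ge0$, all $\mathsf c$, all $\delta\in(0,\frac12)$ and $\tilde\delta\in(0,1)$, (a) $\psi_{\mathsf c}^{t+1}\le f_{K,M}(\delta)\,\mathbf 1\{\nu_{\mathsf c}^t>2+\delta\}+\big(1+h_{K,M}(\nu_{\mathsf c}^t)\big)\,\mathbf 1\{\nu_{\mathsf c}^t\le2+\delta\}$; (b) $\psi_{\mathsf c}^{t+1}\ge\big(1-M^{-\alpha_K\tilde\delta^2}\big)\,\mathbf 1\{\nu_{\mathsf c}^t<2-\tilde\delta\}$.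 As $M\to\infty$, $f_{K,M}(\delta)\to0$ for each $\delta\in(0,\frac12)$, and $h_{K,M}(\nu_M)\to0$ for every sequence $\nu_M\in[\underline\nu,\overline\nu]$. If $K$ is a power of $2$, then (a), non-negativity, the limits and the displayed bounds (the bound on $f_{K,M}(\delta)$ for all $M$ larger than a threshold that may depend on $\delta$) also hold, with the same $\alpha_{1K},\alpha_{2K},M_0$, for the following explicit choices, where $\kappa_1,\dots,\kappa_4>0$ are universal constants: $$f_{K,M}=\frac{(KM)^{-\kappa\delta^2}}{\delta\sqrt{\ln(KM)}}\ \text{ with }\kappa=\kappa_1,\kappa_2,\kappa_3\text{ for }K=1,2,4,$$ $$h_{1,M}=0,\qquad h_{2,M}=\frac{(2M)^{-\nu/2}}{\sqrt{2\pi\nu\ln(2M)}},\qquad h_{4,M}=\frac{2(4M)^{-\nu/2}}{\sqrt{2\pi\nu\ln(4M)}},$$ and for $K\ge8$, with $q=1+\cot(2\pi/K)$, $$f_{K,M}=\frac{q\,(KM)^{-\kappa_4\delta^2/q^2}}{\delta\sqrt{\ln(KM)}}+K(KM)^{-2(2+\delta^2)\sin^2(\pi/K)},\qquad h_{K,M}=\frac{2q\,(KM)^{-\nu/(2q^2)}}{\sqrt{2\pi\nu\ln(KM)}}.$$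 -/

import Mathlib

open MeasureTheory ProbabilityTheory Filter Topology
open scoped NNReal

noncomputable section

namespace ModSparc

/-- The circularly symmetric complex Gaussian law `CN(0, v)`: the real and imaginary parts are
independent real Gaussians of mean `0` and variance `v / 2`. -/
def complexGaussian (v : ℝ≥0) : Measure ℂ :=
  ((gaussianReal 0 (v / 2)).prod (gaussianReal 0 (v / 2))).map
    (fun x : ℝ × ℝ => (⟨x.1, x.2⟩ : ℂ))

/-- The `K`-PSK constellation symbol `p_k = exp(2 π i k / K)`. -/
def psk (K k : ℕ) : ℂ := Complex.exp (2 * Real.pi * k / K * Complex.I)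

/-- The joint law of `(U₁, (U₂, …, U_M))`, with `U₁, …, U_M` i.i.d. `CN(0, 2)`. -/
def noiseLaw (M : ℕ) : Measure (ℂ × (Fin (M - 1) → ℂ)) :=
  (complexGaussian 2).prod (Measure.pi fun _ => complexGaussian 2)

/-- The function `𝓔(τ)` of the state evolution recursion, for `K`-PSK and section size `M`.
The variable `U.1` is `U₁`, and `U.2` lists `U₂, …, U_M`. -/
def scriptE (K M : ℕ) (τ : ℝ) : ℝ :=
  ∫ U : ℂ × (Fin (M - 1) → ℂ),
    (∑ k ∈ Finset.Icc 1 K, (psk K k).re *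
        Real.exp (1 / τ * ((1 + (√τ : ℂ) * U.1) * (starRingEnd ℂ) (psk K k)).re)) /
      ((∑ a ∈ Finset.Icc 1 K,
          Real.exp (1 / τ * ((1 + (√τ : ℂ) * U.1) * (starRingEnd ℂ) (psk K a)).re)) +
        ∑ j, ∑ b ∈ Finset.Icc 1 K,
          Real.exp ((U.2 j * (starRingEnd ℂ) (psk K b)).re / √τ)) ∂(noiseLaw M)

/-- A base matrix `W` (of non-negative variances) of size `rows × cols`, a rate `R > 0` in nats and
a noise standard deviation `σ > 0`, such that all the column averages and all the row averages
of `W` lie in the interval `[ξ₁, ξ₂]`, where `ξ₁, ξ₂ > 0`. -/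
structure System where
  rows : ℕ
  cols : ℕ
  W : Matrix (Fin rows) (Fin cols) ℝ
  R : ℝ
  σ : ℝ
  ξ₁ : ℝ
  ξ₂ : ℝ
  W_nonneg : ∀ r c, 0 ≤ W r c
  R_pos : 0 < R
  σ_pos : 0 < σ
  ξ₁_pos : 0 < ξ₁
  ξ₂_pos : 0 < ξ₂
  col_avg : ∀ c, ξ₁ ≤ 1 / (rows : ℝ) * ∑ r, W r c ∧ 1 / (rows : ℝ) * ∑ r, W r c ≤ ξ₂
  row_avg : ∀ r, ξ₁ ≤ 1 / (cols : ℝ) * ∑ c, W r c ∧ 1 / (cols : ℝ) * ∑ c, W r c ≤ ξ₂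

namespace System

variable (S : System)

/-- `φ_r = σ² + γ_r`, `γ_r = (1/C) ∑_c W_rc ψ_c`, as a function of the vector `ψ`. -/
def phiOf (ψ : Fin S.cols → ℝ) (r : Fin S.rows) : ℝ :=
  S.σ ^ 2 + 1 / (S.cols : ℝ) * ∑ c, S.W r c * ψ c

/-- `τ_c = (R/2)/ln(KM) · [(1/R) ∑_r W_rc / φ_r]⁻¹`, as a function of the vector `ψ`
(inside the bracket, `R` is the number of rows). -/
def tauOf (K M : ℕ) (ψ : Fin S.cols → ℝ) (c : Fin S.cols) : ℝ :=
  (S.R / 2) / Real.log ((K : ℝ) * M) *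
    (1 / (S.rows : ℝ) * ∑ r, S.W r c / S.phiOf ψ r)⁻¹

/-- The state evolution parameters `ψ_c^t`: `ψ_c^0 = 1` and `ψ_c^{t+1} = 1 - 𝓔(τ_c^t)`. -/
def psi (K M : ℕ) : ℕ → Fin S.cols → ℝ
  | 0 => fun _ => 1
  | t + 1 => fun c => 1 - scriptE K M (S.tauOf K M (psi K M t) c)

/-- The state evolution parameters `φ_r^t`. -/
def phi (K M t : ℕ) (r : Fin S.rows) : ℝ := S.phiOf (S.psi K M t) r

/-- The state evolution parameters `τ_c^t`. -/
def tau (K M t : ℕ) (c : Fin S.cols) : ℝ := S.tauOf K M (S.psi K M t) c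

/-- The block signal-to-noise ratio `ν_c^t = 1 / (τ_c^t ln(KM))`. -/
def nu (K M t : ℕ) (c : Fin S.cols) : ℝ :=
  1 / (S.tau K M t c * Real.log ((K : ℝ) * M))

/-- The lower bound `(2/R) ξ₁ / (σ² + 2 ξ₂)` for the `ν_c^t`. -/
def nuLower : ℝ := 2 / S.R * (S.ξ₁ / (S.σ ^ 2 + 2 * S.ξ₂))

/-- The upper bound `(2/R) ξ₂ / σ²` for the `ν_c^t`. -/
def nuUpper : ℝ := 2 / S.R * (S.ξ₂ / S.σ ^ 2)

end System

/-- `(KM)^{-a δ²} / (δ √ln(KM))` -/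
def fBound (a : ℝ) (K M : ℕ) (δ : ℝ) : ℝ :=
  ((K : ℝ) * M) ^ (-(a * δ ^ 2)) / (δ * √(Real.log ((K : ℝ) * M)))

/-- `(KM)^{-a ν} / √(ν ln(KM))` -/
def hBound (a : ℝ) (K M : ℕ) (ν : ℝ) : ℝ :=
  ((K : ℝ) * M) ^ (-(a * ν)) / √(ν * Real.log ((K : ℝ) * M))

/-- The factor `1 + cot(2π/K)`. -/
def cotFactor (K : ℕ) : ℝ := 1 + Real.cot (2 * Real.pi / K)

/-- The explicit expression for `f_{K,M}` when `K` is a power of `2`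
(the last case is used for `K ≥ 8`). -/
def fExact (κ₁ κ₂ κ₃ κ₄ : ℝ) (K M : ℕ) (δ : ℝ) : ℝ :=
  if K = 1 then (M : ℝ) ^ (-(κ₁ * δ ^ 2)) / (δ * √(Real.log M))
  else if K = 2 then (2 * (M : ℝ)) ^ (-(κ₂ * δ ^ 2)) / (δ * √(Real.log (2 * (M : ℝ))))
  else if K = 4 then (4 * (M : ℝ)) ^ (-(κ₃ * δ ^ 2)) / (δ * √(Real.log (4 * (M : ℝ))))
  else
    cotFactor K * ((K : ℝ) * M) ^ (-(κ₄ * δ ^ 2 / cotFactor K ^ 2)) /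
        (δ * √(Real.log ((K : ℝ) * M))) +
      K * ((K : ℝ) * M) ^ (-(2 * (2 + δ ^ 2) * Real.sin (Real.pi / K) ^ 2))

/-- The explicit expression for `h_{K,M}` when `K` is a power of `2`
(the last case is used for `K ≥ 8`). -/
def hExact (K M : ℕ) (ν : ℝ) : ℝ :=
  if K = 1 then 0
  else if K = 2 then (2 * (M : ℝ)) ^ (-(ν / 2)) / √(2 * Real.pi * ν * Real.log (2 * (M : ℝ)))
  else if K = 4 then
    2 * (4 * (M : ℝ)) ^ (-(ν / 2)) / √(2 * Real.pi * ν * Real.log (4 * (M : ℝ)))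
  else
    2 * cotFactor K * ((K : ℝ) * M) ^ (-(ν / (2 * cotFactor K ^ 2))) /
      √(2 * Real.pi * ν * Real.log ((K : ℝ) * M))

/-- `f` (a function of `M` and `δ`) and `h` (a function of `M` and of the signal-to-noise ratio `ν`)
are non-negative for `M ≥ M₀`, vanish as `M → ∞`, and for all `M ≥ M₀` they bound from above the
state evolution parameters of every system whose bounds for `ν_c^t` are `lo` and `hi`:
`ψ_c^{t+1} ≤ f · 1{ν_c^t > 2 + δ} + (1 + h) · 1{ν_c^t ≤ 2 + δ}` for all `δ ∈ (0, 1/2)`. -/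
def UpperBoundsPsi (K : ℕ) (lo hi : ℝ) (M₀ : ℕ) (f h : ℕ → ℝ → ℝ) : Prop :=
  (∀ M, M₀ ≤ M → ∀ δ ∈ Set.Ioo (0 : ℝ) (1 / 2), 0 ≤ f M δ) ∧
  (∀ M, M₀ ≤ M → ∀ ν ∈ Set.Icc lo hi, 0 ≤ h M ν) ∧
  (∀ δ ∈ Set.Ioo (0 : ℝ) (1 / 2), Tendsto (fun M => f M δ) atTop (𝓝 0)) ∧
  (∀ ν : ℕ → ℝ, (∀ M, ν M ∈ Set.Icc lo hi) → Tendsto (fun M => h M (ν M)) atTop (𝓝 0)) ∧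
  ∀ M, M₀ ≤ M → ∀ S : System, S.nuLower = lo → S.nuUpper = hi →
    ∀ (t : ℕ) (c : Fin S.cols), ∀ δ ∈ Set.Ioo (0 : ℝ) (1 / 2),
      S.psi K M (t + 1) c ≤
        (if 2 + δ < S.nu K M t c then f M δ else 0) +
          (if S.nu K M t c ≤ 2 + δ then 1 + h M (S.nu K M t c) else 0)

end ModSparc

end

/-!
Write `c = 1 / τ = ν L` with `L = log (K M)`, and let `s = δ √L`. The integrand of `scriptE` is a
posterior mean: the entry that was sent gives its symbol `p` the weight
`sig c p = exp (c Re p + √c Re (U₁ conj p))`, and the other entries contribute the noise sum `N`.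
Hence `1 - scriptE` is at most the expectation of `min 1 (N / sig c 1)` plus the loss `cross` from
confusing the symbol `1` with another symbol of the same entry. The latter is at most
`2 (K - 1) exp (-c g / 2)` by the Bhattacharyya bound (`integral_cross_le`), where `g > 0` is such
that `1 - Re p ≥ 2 g` for every `p ≠ 1` (`PhaseGap`).

*Upper bounds.* Given `U₁`, the noise sum may be replaced by its mean, which is at most
`exp (L + c / 2)`, so what is left is a one-dimensional Gaussian integral
`E min (1, exp (√c (X - u)))` with `u = (c / 2 - L) / √c`. For `ν > 2 + δ` one has `u ≥ s / √10`,
and a shift of the Gaussian gives `exp (-u² / 2) (1 / 2 + 1 / √c)` (`integral_min_one_exp_le`). The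
factor `1 / 2` is what makes this smaller than `exp (-κ s²) / s` for every `s > 0`, with room for
the lower-order terms once `L` is large (`eventually_above_threshold`); this is uniform in `δ`.
For `ν ≤ 2 + δ` the trivial bound `1` for the Gaussian integral leaves `1 + cross`. When `K` is even,
the reflection `p ↦ -conj p` of the constellation shows that the numerator is non-negative unless
`Re U₁ < -√c`, and Mills' inequality gives the explicit `hExact`
(`one_sub_scriptE_le_of_even`). The explicit `fExact` dominates the general bound because
`cotFactor K * sin (π / K)` is bounded above and below (`cotFactor_bounds`).

*Lower bound.* With overwhelming probability some `Re U_j` exceeds `y = √(2 L) - 1 / 10`, so that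
`N ≥ exp (√c y)`, and `scriptE` is at most the sum over `p` of `E min (1, sig c p exp (-√c y))` up
to a negligible term (`scriptE_le_integral`). The term `p = 1` is again
`E min (1, exp (√c (X - u)))`, now with `u = y - √c ≥ 0.35 s - 0.1`. Since the claimed bound
`exp (-α s²)` carries no constant, small `s` is treated apart: there the expectation is bounded away
from `1`.
-/

namespace ModSparc
open Real

/-! ### One-dimensional Gaussian estimates -/

lemma gaussianPDFReal_std (x : ℝ) :
    gaussianPDFReal 0 1 x = (√(2 * π))⁻¹ * exp (-(x ^ 2 / 2)) := by
  simp [gaussianPDFReal, neg_div]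

lemma inv_sqrt_two_pi_le : (√(2 * π))⁻¹ ≤ 1 / 2 := by
  have h : (2 : ℝ) ≤ √(2 * π) := Real.le_sqrt_of_sq_le (by nlinarith [pi_gt_three])
  rw [one_div]
  exact inv_anti₀ (by norm_num) h

lemma gaussianPDFReal_std_le (x : ℝ) : gaussianPDFReal 0 1 x ≤ 1 / 2 := by
  rw [gaussianPDFReal_std]
  have h1 : exp (-(x ^ 2 / 2)) ≤ 1 := exp_le_one_iff.mpr (by nlinarith [sq_nonneg x])
  calc (√(2 * π))⁻¹ * exp (-(x ^ 2 / 2)) ≤ (√(2 * π))⁻¹ * 1 := by gcongr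
    _ ≤ 1 / 2 := by rw [mul_one]; exact inv_sqrt_two_pi_le

lemma gaussianPDFReal_std_add (w u : ℝ) :
    gaussianPDFReal 0 1 (w + u) = exp (-(u ^ 2 / 2)) * (exp (-(u * w)) * gaussianPDFReal 0 1 w) := by
  simp only [gaussianPDFReal_std]
  have : exp (-((w + u) ^ 2 / 2)) = exp (-(u ^ 2 / 2)) * (exp (-(u * w)) * exp (-(w ^ 2 / 2))) := by
    rw [← exp_add, ← exp_add]; congr 1; ring
  rw [this]; ring

lemma measureReal_gaussian_eq (s : Set ℝ) :
    (gaussianReal 0 1).real s = ∫ x in s, gaussianPDFReal 0 1 x := by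
  rw [measureReal_def, gaussianReal_apply_eq_integral 0 one_ne_zero, ENNReal.toReal_ofReal]
  exact setIntegral_nonneg_of_ae (Eventually.of_forall fun x => gaussianPDFReal_nonneg 0 1 x)

lemma setIntegral_gaussian_Ioi_zero : ∫ x in Set.Ioi 0, gaussianPDFReal 0 1 x = 1 / 2 := by
  have h := integral_gaussian_Ioi (1 / 2)
  have h2 : ∀ x : ℝ, gaussianPDFReal 0 1 x = (√(2 * π))⁻¹ * exp (-(1 / 2) * x ^ 2) := fun x => by
    rw [gaussianPDFReal_std]; congr 2; ring
  simp_rw [h2]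
  rw [integral_const_mul, h]
  have : π / (1 / 2) = 2 * π := by ring
  rw [this]
  have : √(2 * π) ≠ 0 := by positivity
  field_simp

/-- Completing the square moves the centre of the Gaussian to the threshold `u`, which brings out
the factor `exp (-u² / 2)`; what is left is half of a Gaussian mass and an exponential integral. -/
lemma integral_min_one_exp_le {a u : ℝ} (ha : 0 < a) (hu : 0 ≤ u) (hua : u ≤ a / 2) :
    ∫ x, min 1 (exp (a * (x - u))) ∂gaussianReal 0 1 ≤ exp (-(u ^ 2 / 2)) * (1 / 2 + 1 / a) := by
  rw [integral_gaussianReal_eq_integral_smul one_ne_zero]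
  rw [← integral_add_right_eq_self _ u]
  set G : ℝ → ℝ := fun w => exp (-(u ^ 2 / 2)) *
    ((Set.Ioi (0 : ℝ)).indicator (gaussianPDFReal 0 1) w +
      (Set.Iic (0 : ℝ)).indicator (fun w => 1 / 2 * exp (a / 2 * w)) w) with hG
  have hi1 : Integrable ((Set.Ioi (0 : ℝ)).indicator (gaussianPDFReal 0 1)) :=
    (integrable_gaussianPDFReal 0 1).indicator measurableSet_Ioi
  have hi2 : Integrable ((Set.Iic (0 : ℝ)).indicator (fun w => 1 / 2 * exp (a / 2 * w))) :=
    IntegrableOn.integrable_indicator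
      (Integrable.const_mul (integrableOn_exp_mul_Iic (by positivity : 0 < a / 2) 0) _)
      measurableSet_Iic
  have hGi : Integrable G := (hi1.add hi2).const_mul _
  have hle : ∀ w, gaussianPDFReal 0 1 (w + u) • min 1 (exp (a * (w + u - u))) ≤ G w := by
    intro w
    rw [gaussianPDFReal_std_add, hG, smul_eq_mul, mul_assoc]
    refine mul_le_mul_of_nonneg_left ?_ (exp_pos _).le
    have hp := gaussianPDFReal_nonneg 0 1 w
    have hm : 0 ≤ min 1 (exp (a * (w + u - u))) := le_min zero_le_one (exp_pos _).le
    rcases lt_or_ge 0 w with hw | hw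
    · rw [Set.indicator_of_mem (by exact hw), Set.indicator_of_notMem (by simpa using hw), add_zero]
      have h1 : exp (-(u * w)) ≤ 1 := exp_le_one_iff.mpr (by nlinarith)
      calc exp (-(u * w)) * gaussianPDFReal 0 1 w * min 1 (exp (a * (w + u - u)))
          ≤ 1 * gaussianPDFReal 0 1 w * 1 := by gcongr; exact min_le_left _ _
        _ = _ := by ring
    · rw [Set.indicator_of_notMem (by simpa using hw), Set.indicator_of_mem (by exact hw), zero_add]
      calc exp (-(u * w)) * gaussianPDFReal 0 1 w * min 1 (exp (a * (w + u - u)))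
          ≤ exp (-(u * w)) * (1 / 2) * exp (a * w) := by
            gcongr
            · exact gaussianPDFReal_std_le w
            · refine (min_le_right _ _).trans (le_of_eq (by congr 1; ring))
        _ = 1 / 2 * exp ((a - u) * w) := by
            rw [mul_right_comm, ← exp_add, mul_comm]; congr 2; ring
        _ ≤ 1 / 2 * exp (a / 2 * w) := by
            gcongr 1 / 2 * exp ?_
            exact mul_le_mul_of_nonpos_right (by linarith) hw
  calc ∫ w, gaussianPDFReal 0 1 (w + u) • min 1 (exp (a * (w + u - u))) ≤ ∫ w, G w := by
        refine integral_mono_of_nonneg (Eventually.of_forall fun w => ?_) hGi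
          (Eventually.of_forall hle)
        exact smul_nonneg (gaussianPDFReal_nonneg 0 1 _) (le_min zero_le_one (exp_pos _).le)
    _ = exp (-(u ^ 2 / 2)) * (1 / 2 + 1 / a) := by
        rw [hG, integral_const_mul, integral_add hi1 hi2, integral_indicator measurableSet_Ioi,
          integral_indicator measurableSet_Iic, setIntegral_gaussian_Ioi_zero, integral_const_mul,
          integral_exp_mul_Iic (by positivity)]
        simp
        ring

/-- Mills' upper bound for the Gaussian tail. -/
lemma gaussian_Ioi_le {u : ℝ} (hu : 0 < u) :
    (gaussianReal 0 1).real (Set.Ioi u) ≤ exp (-(u ^ 2 / 2)) / (√(2 * π) * u) := by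
  rw [measureReal_gaussian_eq, ← integral_indicator measurableSet_Ioi,
    ← integral_add_right_eq_self _ u]
  have hi : IntegrableOn (fun w => (√(2 * π))⁻¹ * exp (-u * w)) (Set.Ioi 0) :=
    (integrableOn_exp_mul_Ioi (neg_lt_zero.mpr hu) 0).const_mul _
  have hGi := (hi.integrable_indicator measurableSet_Ioi).const_mul (exp (-(u ^ 2 / 2)))
  calc _ ≤ ∫ w, exp (-(u ^ 2 / 2)) *
          (Set.Ioi (0 : ℝ)).indicator (fun w => (√(2 * π))⁻¹ * exp (-u * w)) w := by
        refine integral_mono_of_nonneg (Eventually.of_forall fun w => ?_) hGi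
          (Eventually.of_forall fun w => ?_)
        · exact Set.indicator_nonneg (fun x _ => gaussianPDFReal_nonneg 0 1 x) _
        · rcases lt_or_ge 0 w with hw | hw
          · beta_reduce
            rw [Set.indicator_of_mem (by simpa using hw), Set.indicator_of_mem (by exact hw),
              gaussianPDFReal_std_add, gaussianPDFReal_std]
            gcongr exp (-(u ^ 2 / 2)) * ?_
            have h1 : exp (-(w ^ 2 / 2)) ≤ 1 := exp_le_one_iff.mpr (by nlinarith [sq_nonneg w])
            calc exp (-(u * w)) * ((√(2 * π))⁻¹ * exp (-(w ^ 2 / 2)))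
                ≤ exp (-(u * w)) * ((√(2 * π))⁻¹ * 1) := by gcongr
              _ = _ := by rw [neg_mul]; ring
          · beta_reduce
            rw [Set.indicator_of_notMem (by simpa using hw),
              Set.indicator_of_notMem (by simpa using hw), mul_zero]
    _ = _ := by
        rw [integral_const_mul, integral_indicator measurableSet_Ioi, integral_const_mul,
          integral_exp_mul_Ioi (neg_lt_zero.mpr hu)]
        have : √(2 * π) ≠ 0 := by positivity
        simp
        field_simp

lemma gaussian_Iio_neg (u : ℝ) :
    (gaussianReal 0 1).real (Set.Iio (-u)) = (gaussianReal 0 1).real (Set.Ioi u) := by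
  conv_lhs => rw [← neg_zero, ← gaussianReal_map_neg (μ := 0) (v := 1)]
  rw [map_measureReal_apply (by fun_prop) measurableSet_Iio]
  congr 1
  ext x
  simp

/-- A lower bound for the Gaussian tail beyond `y`, from the mass of `[y, y + h]`. -/
lemma le_gaussian_Ici {y h : ℝ} (hy : 0 ≤ y) (hh : 0 ≤ h) :
    h * gaussianPDFReal 0 1 (y + h) ≤ (gaussianReal 0 1).real (Set.Ici y) := by
  calc h * gaussianPDFReal 0 1 (y + h) = ∫ _ in Set.Icc y (y + h), gaussianPDFReal 0 1 (y + h) := by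
        simp [hh]
    _ ≤ ∫ x in Set.Icc y (y + h), gaussianPDFReal 0 1 x := by
        refine setIntegral_mono_on (by simp) (integrable_gaussianPDFReal 0 1).integrableOn
          measurableSet_Icc fun x hx => ?_
        rw [gaussianPDFReal_std, gaussianPDFReal_std]
        have : x ^ 2 ≤ (y + h) ^ 2 := by
          have := hx.1; have := hx.2
          gcongr
          linarith
        gcongr
    _ = (gaussianReal 0 1).real (Set.Icc y (y + h)) := (measureReal_gaussian_eq _).symm
    _ ≤ _ := measureReal_mono fun x hx => hx.1

lemma gaussian_Ioi_neg_le {r : ℝ} (hr : 0 ≤ r) :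
    (gaussianReal 0 1).real (Set.Ioi (-r)) ≤ 1 / 2 + r / 2 := by
  have hsub : Set.Ioi (-r) ⊆ Set.Icc (-r) 0 ∪ Set.Ioi 0 := fun x hx => by
    rcases le_or_gt x 0 with h | h
    · exact Or.inl ⟨le_of_lt hx, h⟩
    · exact Or.inr h
  have h1 : (gaussianReal 0 1).real (Set.Icc (-r) 0) ≤ r / 2 := by
    rw [measureReal_gaussian_eq]
    calc _ ≤ ∫ _ in Set.Icc (-r) 0, (1 / 2 : ℝ) :=
          setIntegral_mono_on (integrable_gaussianPDFReal 0 1).integrableOn (by simp)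
            measurableSet_Icc fun x _ => gaussianPDFReal_std_le x
      _ = r / 2 := by simp [hr]; ring
  have h2 : (gaussianReal 0 1).real (Set.Ioi 0) = 1 / 2 := by
    rw [measureReal_gaussian_eq, setIntegral_gaussian_Ioi_zero]
  calc _ ≤ (gaussianReal 0 1).real (Set.Icc (-r) 0 ∪ Set.Ioi 0) := measureReal_mono hsub
    _ ≤ _ := measureReal_union_le _ _
    _ ≤ _ := by linarith

lemma integral_exp_mul_gaussian (t : ℝ) : ∫ x, exp (t * x) ∂gaussianReal 0 1 = exp (t ^ 2 / 2) := by
  have := congrFun (mgf_id_gaussianReal (μ := 0) (v := 1)) t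
  simpa [mgf] using this

/-- With a fixed margin `r` on the wrong side of the threshold, the expectation is still bounded
away from `1`. -/
lemma integral_min_one_exp_add_le {a r : ℝ} (ha : 0 < a) (hr : 0 ≤ r) :
    ∫ x, min 1 (exp (a * (x + r))) ∂gaussianReal 0 1 ≤ 1 / 2 + r + exp (-(a * r)) := by
  have hle : ∀ x : ℝ, min 1 (exp (a * (x + r))) ≤
      (Set.Ioi (-(2 * r))).indicator (fun _ => (1 : ℝ)) x + exp (-(a * r)) := fun x => by
    by_cases hx : x ∈ Set.Ioi (-(2 * r))
    · rw [Set.indicator_of_mem hx]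
      linarith [min_le_left 1 (exp (a * (x + r))), exp_pos (-(a * r))]
    · rw [Set.indicator_of_notMem hx, zero_add]
      refine (min_le_right _ _).trans (exp_le_exp.mpr ?_)
      have : x ≤ -(2 * r) := by simpa using hx
      nlinarith
  have hi : Integrable ((Set.Ioi (-(2 * r))).indicator (fun _ => (1 : ℝ))) (gaussianReal 0 1) :=
    (integrable_const _).indicator measurableSet_Ioi
  calc _ ≤ ∫ x, ((Set.Ioi (-(2 * r))).indicator (fun _ => (1 : ℝ)) x + exp (-(a * r)))
            ∂gaussianReal 0 1 :=
        integral_mono_of_nonneg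
          (Eventually.of_forall fun x => le_min zero_le_one (exp_pos _).le)
          (hi.add (integrable_const _)) (Eventually.of_forall hle)
    _ = (gaussianReal 0 1).real (Set.Ioi (-(2 * r))) + exp (-(a * r)) := by
        rw [integral_add hi (integrable_const _), integral_indicator measurableSet_Ioi]
        simp
    _ ≤ _ := by linarith [gaussian_Ioi_neg_le (r := 2 * r) (by linarith)]

/-! ### The complex Gaussian law -/

lemma complexGaussian_two : complexGaussian 2 =
    ((gaussianReal 0 1).prod (gaussianReal 0 1)).map Complex.measurableEquivRealProd.symm := by
  have : (2 / 2 : ℝ≥0) = 1 := div_self two_ne_zero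
  rw [complexGaussian, this]
  rfl

instance : IsProbabilityMeasure (complexGaussian 2) := by
  rw [complexGaussian_two]
  exact Measure.isProbabilityMeasure_map Complex.measurableEquivRealProd.symm.measurable.aemeasurable

instance (M : ℕ) : IsProbabilityMeasure (noiseLaw M) := by
  unfold noiseLaw; infer_instance

lemma complexGaussian_map_re : (complexGaussian 2).map Complex.re = gaussianReal 0 1 := by
  rw [complexGaussian_two, Measure.map_map Complex.measurable_re
    Complex.measurableEquivRealProd.symm.measurable]
  have : Complex.re ∘ Complex.measurableEquivRealProd.symm = Prod.fst := rfl
  rw [this]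
  exact Measure.map_fst_prod.trans (by simp)

lemma integral_comp_re {f : ℝ → ℝ} (hf : Measurable f) :
    ∫ z, f z.re ∂complexGaussian 2 = ∫ x, f x ∂gaussianReal 0 1 := by
  rw [← complexGaussian_map_re, integral_map Complex.measurable_re.aemeasurable
    hf.aestronglyMeasurable]

/-- The real inner product of `z` and `p` in the plane, as it enters `scriptE`. -/
def lin (p z : ℂ) : ℝ := (z * (starRingEnd ℂ) p).re

lemma lin_eq (p z : ℂ) : lin p z = p.re * z.re + p.im * z.im := by
  simp [lin]; ring

@[fun_prop]
lemma continuous_lin (p : ℂ) : Continuous (lin p) := by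
  unfold lin; fun_prop

lemma lin_one (z : ℂ) : lin 1 z = z.re := by simp [lin]

lemma lin_sub (p q z : ℂ) : lin (p - q) z = lin p z - lin q z := by simp [lin_eq]; ring

lemma integrable_exp_lin (t : ℝ) (p : ℂ) :
    Integrable (fun z => exp (t * lin p z)) (complexGaussian 2) := by
  rw [complexGaussian_two, (MeasurableEquiv.measurableEmbedding _).integrable_map_iff]
  have h : ((fun z => exp (t * lin p z)) ∘ Complex.measurableEquivRealProd.symm) =
      fun x : ℝ × ℝ => exp (t * p.re * x.1) * exp (t * p.im * x.2) := by
    funext x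
    simp only [Function.comp, lin_eq, ← exp_add]
    congr 1
    change t * (p.re * x.1 + p.im * x.2) = _
    ring
  rw [h]
  exact (integrable_exp_mul_gaussianReal _).mul_prod (integrable_exp_mul_gaussianReal _)

/-- The moment generating function of `CN(0, 2)`. -/
lemma integral_exp_lin (t : ℝ) (p : ℂ) :
    ∫ z, exp (t * lin p z) ∂complexGaussian 2 = exp (t ^ 2 * Complex.normSq p / 2) := by
  rw [complexGaussian_two, (MeasurableEquiv.measurableEmbedding _).integral_map]
  have h : ∀ x : ℝ × ℝ, exp (t * lin p (Complex.measurableEquivRealProd.symm x)) =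
      exp (t * p.re * x.1) * exp (t * p.im * x.2) := by
    intro x
    simp only [lin_eq, ← exp_add]
    congr 1
    change t * (p.re * x.1 + p.im * x.2) = _
    ring
  simp_rw [h]
  rw [integral_prod_mul (fun x => exp (t * p.re * x)) (fun x => exp (t * p.im * x)),
    integral_exp_mul_gaussian, integral_exp_mul_gaussian, ← exp_add, Complex.normSq_apply]
  congr 1; ring

/-! ### The constellation -/

lemma psk_eq (K k : ℕ) : psk K k = Complex.exp ((2 * π * k / K : ℝ) * Complex.I) := by
  simp [psk]

lemma psk_re (K k : ℕ) : (psk K k).re = cos (2 * π * k / K) := by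
  rw [psk_eq, Complex.exp_ofReal_mul_I_re]

lemma psk_im (K k : ℕ) : (psk K k).im = sin (2 * π * k / K) := by
  rw [psk_eq, Complex.exp_ofReal_mul_I_im]

lemma psk_self {K : ℕ} (hK : 1 ≤ K) : psk K K = 1 := by
  have : (K : ℝ) ≠ 0 := by positivity
  apply Complex.ext
  · rw [psk_re, mul_div_cancel_right₀ _ this, cos_two_pi]; rfl
  · rw [psk_im, mul_div_cancel_right₀ _ this, sin_two_pi]; rfl

lemma psk_re_le_one (K k : ℕ) : (psk K k).re ≤ 1 := by rw [psk_re]; exact cos_le_one _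

lemma neg_one_le_psk_re (K k : ℕ) : -1 ≤ (psk K k).re := by rw [psk_re]; exact neg_one_le_cos _

lemma normSq_psk (K k : ℕ) : Complex.normSq (psk K k) = 1 := by
  rw [Complex.normSq_apply, psk_re, psk_im, ← sq, ← sq, cos_sq_add_sin_sq]

lemma normSq_psk_sub_one (K k : ℕ) :
    Complex.normSq (psk K k - 1) = 2 * (1 - (psk K k).re) := by
  have := normSq_psk K k
  rw [Complex.normSq_apply] at this ⊢
  simp
  linarith

/-- Every symbol of the constellation other than `1` has real part at most `1 - 2 g`. -/
def PhaseGap (K : ℕ) (g : ℝ) : Prop :=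
  ∀ k ∈ Finset.Icc 1 K, k ≠ K → 2 * g ≤ 1 - (psk K k).re

lemma phaseGap_one : PhaseGap 1 1 := fun k hk hne => by simp at hk; omega

lemma phaseGap_sin {K : ℕ} (hK : 2 ≤ K) : PhaseGap K (sin (π / K) ^ 2) := by
  intro k hk hne
  have hk := Finset.mem_Icc.mp hk
  have hlt : k + 1 ≤ K := by omega
  have hlt' : (k : ℝ) + 1 ≤ K := by exact_mod_cast hlt
  have hk1 : (1 : ℝ) ≤ k := by exact_mod_cast hk.1
  have hK' : (2 : ℝ) ≤ K := by exact_mod_cast hK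
  have hpi := pi_pos
  have h1 : π / K ≤ π * k / K := by gcongr; nlinarith
  have h2 : π * k / K ≤ π - π / K := by
    rw [div_le_iff₀ (by linarith), sub_mul, div_mul_cancel₀ _ (by linarith)]; nlinarith
  have h3 : π / K ≤ π / 2 := by gcongr
  have h4 : sin (π / K) ≤ sin (π * k / K) := by
    rw [← cos_pi_div_two_sub, ← cos_pi_div_two_sub, ← cos_abs (π / 2 - π * k / K)]
    refine cos_le_cos_of_nonneg_of_le_pi (abs_nonneg _) ?_ ?_
    · have : 0 < π / K := by positivity
      linarith
    · rw [abs_le]; constructor <;> linarith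
  have h5 : 0 ≤ sin (π / K) := sin_nonneg_of_nonneg_of_le_pi (by positivity) (by linarith)
  have h6 : (psk K k).re = 1 - 2 * sin (π * k / K) ^ 2 := by
    rw [psk_re, show 2 * π * k / K = 2 * (π * k / K) by ring, cos_two_mul, cos_sq']; ring
  rw [h6]
  have := pow_le_pow_left₀ h5 h4 2
  linarith

/-- For even `K`, the constellation is invariant under the reflection `p ↦ -conj p`. -/
lemma sum_psk_reflect (m : ℕ) (F : ℝ → ℝ → ℝ) :
    ∑ k ∈ Finset.Icc 1 (2 * m), F (psk (2 * m) k).re (psk (2 * m) k).im =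
      ∑ k ∈ Finset.Icc 1 (2 * m), F (-(psk (2 * m) k).re) (psk (2 * m) k).im := by
  refine Finset.sum_nbij' (fun k => if k < m then m - k else 3 * m - k)
    (fun k => if k < m then m - k else 3 * m - k) ?_ ?_ ?_ ?_ ?_
  · intro k hk
    simp only [Finset.mem_Icc] at hk ⊢
    split_ifs <;> omega
  · intro k hk
    simp only [Finset.mem_Icc] at hk ⊢
    split_ifs <;> omega
  · intro k hk
    simp only [Finset.mem_Icc] at hk ⊢
    split_ifs <;> omega
  · intro k hk
    simp only [Finset.mem_Icc] at hk ⊢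
    split_ifs <;> omega
  · intro k hk
    simp only [Finset.mem_Icc] at hk
    have hm : (m : ℝ) ≠ 0 := by
      have : m ≠ 0 := by omega
      exact_mod_cast this
    simp only [psk_re, psk_im]
    split_ifs with h
    · have : 2 * π * ((m - k : ℕ) : ℝ) / ((2 * m : ℕ) : ℝ) = π - 2 * π * k / ((2 * m : ℕ) : ℝ) := by
        rw [Nat.cast_sub h.le]; push_cast; field_simp
      rw [this, cos_pi_sub, sin_pi_sub, neg_neg]
    · have : 2 * π * ((3 * m - k : ℕ) : ℝ) / ((2 * m : ℕ) : ℝ) =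
          π - 2 * π * k / ((2 * m : ℕ) : ℝ) + 2 * π := by
        rw [Nat.cast_sub (by omega)]; push_cast; field_simp; ring
      rw [this, cos_add_two_pi, sin_add_two_pi, cos_pi_sub, sin_pi_sub, neg_neg]

lemma mul_exp_sub_nonneg {A : ℝ} (hA : 0 ≤ A) (x : ℝ) :
    0 ≤ x * (exp (A * x) - exp (-(A * x))) := by
  rcases le_total 0 x with hx | hx
  · have : exp (-(A * x)) ≤ exp (A * x) := exp_le_exp.mpr (by nlinarith [mul_nonneg hA hx])
    exact mul_nonneg hx (by linarith)
  · have : exp (A * x) ≤ exp (-(A * x)) :=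
      exp_le_exp.mpr (by nlinarith [mul_nonneg hA (neg_nonneg.mpr hx)])
    exact mul_nonneg_of_nonpos_of_nonpos hx (by linarith)

/-- Symmetrizing under the reflection turns the sum into `∑ x sinh (A x) exp (B y)`. -/
lemma sum_psk_re_mul_exp_nonneg (m : ℕ) {A : ℝ} (hA : 0 ≤ A) (B : ℝ) :
    0 ≤ ∑ k ∈ Finset.Icc 1 (2 * m),
      (psk (2 * m) k).re * exp (A * (psk (2 * m) k).re + B * (psk (2 * m) k).im) := by
  have h := sum_psk_reflect m fun x y => x * exp (A * x + B * y)
  beta_reduce at h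
  have h2 : 0 ≤ ∑ k ∈ Finset.Icc 1 (2 * m),
      ((psk (2 * m) k).re * exp (A * (psk (2 * m) k).re + B * (psk (2 * m) k).im) +
      -(psk (2 * m) k).re * exp (A * -(psk (2 * m) k).re + B * (psk (2 * m) k).im)) := by
    refine Finset.sum_nonneg fun k _ => ?_
    rw [exp_add, exp_add, mul_neg]
    have := mul_nonneg (mul_exp_sub_nonneg hA (psk (2 * m) k).re)
      (exp_pos (B * (psk (2 * m) k).im)).le
    linarith
  rw [Finset.sum_add_distrib, ← h] at h2
  linarith

/-! ### The integrand of `scriptE` at inverse noise level `c = 1 / τ` -/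

/-- The posterior weight of the symbol `p` in the section entry that was sent. -/
noncomputable def sig (c : ℝ) (p z : ℂ) : ℝ := exp (c * p.re + √c * lin p z)

/-- The total weight of the entry that was sent. -/
noncomputable def sigSum (K : ℕ) (c : ℝ) (z : ℂ) : ℝ := ∑ k ∈ Finset.Icc 1 K, sig c (psk K k) z

/-- The numerator of the posterior mean of the entry that was sent. -/
noncomputable def sigNum (K : ℕ) (c : ℝ) (z : ℂ) : ℝ := ∑ k ∈ Finset.Icc 1 K, (psk K k).re * sig c (psk K k) z

/-- The total weight of all the other entries of the section. -/
noncomputable def noiseSum (K : ℕ) {M : ℕ} (c : ℝ) (v : Fin (M - 1) → ℂ) : ℝ :=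
  ∑ j, ∑ b ∈ Finset.Icc 1 K, exp (√c * lin (psk K b) (v j))

/-- The integrand of `scriptE`. -/
noncomputable def ratio (K M : ℕ) (c : ℝ) (U : ℂ × (Fin (M - 1) → ℂ)) : ℝ :=
  sigNum K c U.1 / (sigSum K c U.1 + noiseSum K c U.2)

/-- The loss caused by confusing the symbol `1` with another symbol of the same entry. -/
noncomputable def cross (K : ℕ) (c : ℝ) (z : ℂ) : ℝ :=
  ∑ k ∈ Finset.Icc 1 K, (1 - (psk K k).re) * sig c (psk K k) z / sigSum K c z

lemma scriptE_eq (K M : ℕ) {c : ℝ} (hc : 0 < c) :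
    scriptE K M (1 / c) = ∫ U, ratio K M c U ∂noiseLaw M := by
  have hs : √c * √c = c := mul_self_sqrt hc.le
  have hs0 : 0 < √c := sqrt_pos.mpr hc
  unfold scriptE
  congr 1
  funext U
  have h1 : ∀ k, exp (1 / (1 / c) * ((1 + (√(1 / c) : ℂ) * U.1) * (starRingEnd ℂ) (psk K k)).re) =
      sig c (psk K k) U.1 := by
    intro k
    unfold sig
    congr 1
    have h : ((1 + (√(1 / c) : ℂ) * U.1) * (starRingEnd ℂ) (psk K k)).re =
        (psk K k).re + (√c)⁻¹ * lin (psk K k) U.1 := by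
      rw [lin, add_mul, mul_assoc, Complex.add_re, Complex.re_ofReal_mul, one_mul, Complex.conj_re,
        one_div, sqrt_inv]
    rw [h, one_div_one_div]
    nth_rewrite 1 3 [← hs]
    field_simp
  have h2 : ∀ j b, exp ((U.2 j * (starRingEnd ℂ) (psk K b)).re / √(1 / c)) =
      exp (√c * lin (psk K b) (U.2 j)) := by
    intro j b
    congr 1
    rw [one_div, sqrt_inv, div_inv_eq_mul, mul_comm, lin]
  simp only [h1, h2]
  rfl

lemma sig_pos (c : ℝ) (p z : ℂ) : 0 < sig c p z := exp_pos _

@[fun_prop]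
lemma continuous_sig (c : ℝ) (p : ℂ) : Continuous (sig c p) := by unfold sig; fun_prop

@[fun_prop]
lemma continuous_sigSum (K : ℕ) (c : ℝ) : Continuous (sigSum K c) := by unfold sigSum; fun_prop

@[fun_prop]
lemma continuous_sigNum (K : ℕ) (c : ℝ) : Continuous (sigNum K c) := by unfold sigNum; fun_prop

@[fun_prop]
lemma continuous_noiseSum (K M : ℕ) (c : ℝ) : Continuous (noiseSum K (M := M) c) := by
  unfold noiseSum; fun_prop

lemma sig_le_sigSum {K k : ℕ} (hk : k ∈ Finset.Icc 1 K) (c : ℝ) (z : ℂ) :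
    sig c (psk K k) z ≤ sigSum K c z :=
  Finset.single_le_sum (f := fun k => sig c (psk K k) z) (fun _ _ => (sig_pos _ _ _).le) hk

lemma sigSum_pos {K : ℕ} (hK : 1 ≤ K) (c : ℝ) (z : ℂ) : 0 < sigSum K c z :=
  (sig_pos c (psk K K) z).trans_le (sig_le_sigSum (Finset.mem_Icc.mpr ⟨hK, le_rfl⟩) c z)

lemma noiseSum_nonneg (K : ℕ) {M : ℕ} (c : ℝ) (v : Fin (M - 1) → ℂ) : 0 ≤ noiseSum K c v :=
  Finset.sum_nonneg fun _ _ => Finset.sum_nonneg fun _ _ => (exp_pos _).le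

lemma abs_sigNum_le (K : ℕ) (c : ℝ) (z : ℂ) : |sigNum K c z| ≤ sigSum K c z := by
  refine (Finset.abs_sum_le_sum_abs _ _).trans (Finset.sum_le_sum fun k _ => ?_)
  rw [abs_mul, abs_of_pos (sig_pos _ _ _)]
  have : |(psk K k).re| ≤ 1 := abs_le.mpr ⟨neg_one_le_psk_re K k, psk_re_le_one K k⟩
  nlinarith [sig_pos c (psk K k) z]

lemma abs_ratio_le {K : ℕ} (hK : 1 ≤ K) (M : ℕ) (c : ℝ) (U : ℂ × (Fin (M - 1) → ℂ)) :
    |ratio K M c U| ≤ 1 := by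
  have h1 := sigSum_pos hK c U.1
  have h2 := noiseSum_nonneg K c U.2
  rw [ratio, abs_div, abs_of_pos (by linarith : 0 < sigSum K c U.1 + noiseSum K c U.2),
    div_le_one (by linarith)]
  linarith [abs_sigNum_le K c U.1]

lemma continuous_ratio {K : ℕ} (hK : 1 ≤ K) (M : ℕ) (c : ℝ) : Continuous (ratio K M c) := by
  unfold ratio
  refine Continuous.div (by fun_prop) (by fun_prop) fun U => ?_
  linarith [sigSum_pos hK c U.1, noiseSum_nonneg K c U.2]

lemma integrable_ratio {K : ℕ} (hK : 1 ≤ K) (M : ℕ) (c : ℝ) :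
    Integrable (ratio K M c) (noiseLaw M) :=
  .of_bound (continuous_ratio hK M c).aestronglyMeasurable 1
    (Eventually.of_forall fun U => abs_ratio_le hK M c U)

lemma scriptE_le_one {K : ℕ} (hK : 1 ≤ K) (M : ℕ) {c : ℝ} (hc : 0 < c) :
    scriptE K M (1 / c) ≤ 1 := by
  rw [scriptE_eq K M hc]
  calc _ ≤ ∫ _, (1 : ℝ) ∂noiseLaw M := integral_mono (integrable_ratio hK M c)
        (integrable_const _) fun U => (abs_le.mp (abs_ratio_le hK M c U)).2
    _ = 1 := by simp

lemma neg_one_le_scriptE {K : ℕ} (hK : 1 ≤ K) (M : ℕ) {c : ℝ} (hc : 0 < c) :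
    -1 ≤ scriptE K M (1 / c) := by
  rw [scriptE_eq K M hc]
  calc (-1 : ℝ) = ∫ _, (-1 : ℝ) ∂noiseLaw M := by simp
    _ ≤ _ := integral_mono (integrable_const _) (integrable_ratio hK M c)
        fun U => (abs_le.mp (abs_ratio_le hK M c U)).1

/-- An upper bound for `1 - scriptE` from an integrable upper bound for `1 - ratio`. -/
lemma one_sub_scriptE_le {K : ℕ} (hK : 1 ≤ K) (M : ℕ) {c : ℝ} (hc : 0 < c)
    {G : ℂ × (Fin (M - 1) → ℂ) → ℝ} (hG : Integrable G (noiseLaw M))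
    (h : ∀ U, 1 - ratio K M c U ≤ G U) : 1 - scriptE K M (1 / c) ≤ ∫ U, G U ∂noiseLaw M := by
  rw [scriptE_eq K M hc]
  calc 1 - ∫ U, ratio K M c U ∂noiseLaw M = ∫ U, (1 - ratio K M c U) ∂noiseLaw M := by
        rw [integral_sub (integrable_const _) (integrable_ratio hK M c)]; simp
    _ ≤ _ := integral_mono ((integrable_const _).sub (integrable_ratio hK M c)) hG h

lemma integral_noiseLaw_fst (M : ℕ) (f : ℂ → ℝ) :
    ∫ U, f U.1 ∂noiseLaw M = ∫ z, f z ∂complexGaussian 2 := by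
  rw [noiseLaw, integral_fun_fst]; simp

lemma integrable_noiseLaw_fst (M : ℕ) {f : ℂ → ℝ} (hf : Integrable f (complexGaussian 2)) :
    Integrable (fun U : ℂ × (Fin (M - 1) → ℂ) => f U.1) (noiseLaw M) :=
  hf.comp_fst _

/-! ### Confusion within the entry that was sent -/

lemma cross_nonneg {K : ℕ} (hK : 1 ≤ K) (c : ℝ) (z : ℂ) : 0 ≤ cross K c z :=
  Finset.sum_nonneg fun k _ => div_nonneg (mul_nonneg
    (sub_nonneg.mpr (psk_re_le_one K k)) (sig_pos _ _ _).le) (sigSum_pos hK c z).le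

lemma cross_eq (K : ℕ) (c : ℝ) (z : ℂ) :
    cross K c z = (sigSum K c z - sigNum K c z) / sigSum K c z := by
  rw [cross, ← Finset.sum_div, sigSum, sigNum, ← Finset.sum_sub_distrib]
  congr 1
  exact Finset.sum_congr rfl fun k _ => by ring

lemma integrable_cross {K : ℕ} (hK : 1 ≤ K) (c : ℝ) :
    Integrable (cross K c) (complexGaussian 2) := by
  have hcont : Continuous (cross K c) := by
    have : cross K c = fun z => (sigSum K c z - sigNum K c z) / sigSum K c z :=
      funext (cross_eq K c)
    rw [this]
    exact Continuous.div (by fun_prop) (by fun_prop) fun z => (sigSum_pos hK c z).ne'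
  refine .of_bound hcont.aestronglyMeasurable 2 (Eventually.of_forall fun z => ?_)
  rw [norm_eq_abs, abs_of_nonneg (cross_nonneg hK c z), cross_eq, div_le_iff₀ (sigSum_pos hK c z)]
  linarith [(abs_le.mp (abs_sigNum_le K c z)).1]

/-- Each confusion term is controlled by the Bhattacharyya bound
`E √(sig p / sig 1) = exp (-c (1 - Re p) / 4)`. -/
lemma integral_cross_le {K : ℕ} (hK : 1 ≤ K) {c g : ℝ} (hc : 0 < c) (hg : PhaseGap K g) :
    ∫ z, cross K c z ∂complexGaussian 2 ≤ 2 * ((K : ℝ) - 1) * exp (-(c * g / 2)) := by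
  set s := (Finset.Icc 1 K).erase K with hs
  have hKmem : K ∈ Finset.Icc 1 K := Finset.mem_Icc.mpr ⟨hK, le_rfl⟩
  have hp : ∀ k ∈ s, ∀ z, (1 - (psk K k).re) * sig c (psk K k) z / sigSum K c z ≤
      2 * (exp (-(c * (1 - (psk K k).re) / 2)) * exp (√c / 2 * lin (psk K k - 1) z)) := by
    intro k hk z
    have hpos := sigSum_pos hK c z
    rw [div_le_iff₀ hpos, mul_assoc]
    have h0 := neg_one_le_psk_re K k
    refine mul_le_mul (by linarith) ?_ (sig_pos _ _ _).le (by norm_num)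
    rw [← exp_add]
    have hS : exp ((c * (psk K k).re + √c * lin (psk K k) z) / 2 + (c + √c * lin 1 z) / 2) ≤
        sigSum K c z := by
      have h1 := sig_le_sigSum (Finset.mem_of_mem_erase hk) c z
      have h2 := sig_le_sigSum hKmem c z
      rw [psk_self hK] at h2
      simp only [sig, Complex.one_re, mul_one] at h1 h2
      rcases le_total (c * (psk K k).re + √c * lin (psk K k) z) (c + √c * lin 1 z) with h | h
      · exact (exp_le_exp.mpr (by linarith)).trans h2
      · exact (exp_le_exp.mpr (by linarith)).trans h1
    calc sig c (psk K k) z = exp (-(c * (1 - (psk K k).re) / 2) + √c / 2 * lin (psk K k - 1) z) *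
          exp ((c * (psk K k).re + √c * lin (psk K k) z) / 2 + (c + √c * lin 1 z) / 2) := by
          rw [← exp_add, sig, lin_sub]; congr 1; ring
      _ ≤ _ := by gcongr
  have hint : ∀ k ∈ s, Integrable (fun z => 2 * (exp (-(c * (1 - (psk K k).re) / 2)) *
      exp (√c / 2 * lin (psk K k - 1) z))) (complexGaussian 2) := fun k _ =>
    ((integrable_exp_lin _ _).const_mul _).const_mul _
  calc ∫ z, cross K c z ∂complexGaussian 2
      ≤ ∫ z, ∑ k ∈ s, 2 * (exp (-(c * (1 - (psk K k).re) / 2)) *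
          exp (√c / 2 * lin (psk K k - 1) z)) ∂complexGaussian 2 := by
        refine integral_mono (integrable_cross hK c) (integrable_finsetSum _ hint) fun z => ?_
        beta_reduce
        rw [cross, ← Finset.add_sum_erase _ _ hKmem, psk_self hK]
        simp only [Complex.one_re, sub_self, zero_mul, zero_div, zero_add]
        exact Finset.sum_le_sum fun k hk => hp k hk z
    _ = ∑ k ∈ s, 2 * exp (-(c * (1 - (psk K k).re) / 4)) := by
        rw [integral_finsetSum _ hint]
        refine Finset.sum_congr rfl fun k _ => ?_
        rw [integral_const_mul, integral_const_mul, integral_exp_lin, normSq_psk_sub_one, ← exp_add,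
          div_pow, sq_sqrt hc.le]
        congr 2; ring
    _ ≤ ∑ k ∈ s, 2 * exp (-(c * g / 2)) := by
        refine Finset.sum_le_sum fun k hk => ?_
        have := hg k (Finset.mem_of_mem_erase hk) (Finset.ne_of_mem_erase hk)
        gcongr 2 * exp ?_
        nlinarith
    _ = 2 * ((K : ℝ) - 1) * exp (-(c * g / 2)) := by
        rw [Finset.sum_const, hs, Finset.card_erase_of_mem hKmem, Nat.card_Icc, nsmul_eq_mul,
          Nat.add_sub_cancel, Nat.cast_sub hK]
        push_cast; ring

/-! ### Upper bounds for `1 - scriptE` -/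

lemma integrable_exp_lin_eval {n : ℕ} (t : ℝ) (p : ℂ) (j : Fin n) :
    Integrable (fun v : Fin n → ℂ => exp (t * lin p (v j)))
      (Measure.pi fun _ => complexGaussian 2) :=
  integrable_comp_eval (μ := fun _ : Fin n => complexGaussian 2) (i := j)
    (f := fun z => exp (t * lin p z)) (integrable_exp_lin t p)

lemma integral_exp_lin_eval {n : ℕ} (t : ℝ) (p : ℂ) (j : Fin n) :
    ∫ v : Fin n → ℂ, exp (t * lin p (v j)) ∂(Measure.pi fun _ => complexGaussian 2) =
      exp (t ^ 2 * Complex.normSq p / 2) := by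
  rw [← integral_exp_lin]
  exact integral_comp_eval (μ := fun _ : Fin n => complexGaussian 2) (i := j)
    (f := fun z => exp (t * lin p z)) (integrable_exp_lin t p).aestronglyMeasurable

lemma integrable_noiseSum (K M : ℕ) (c : ℝ) :
    Integrable (noiseSum K (M := M) c) (Measure.pi fun _ => complexGaussian 2) :=
  integrable_finsetSum _ fun j _ => integrable_finsetSum _ fun _ _ =>
    integrable_exp_lin_eval _ _ j

lemma integral_noiseSum (K M : ℕ) {c : ℝ} (hc : 0 < c) :
    ∫ v, noiseSum K (M := M) c v ∂(Measure.pi fun _ => complexGaussian 2) =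
      ((M - 1 : ℕ) : ℝ) * (K * exp (c / 2)) := by
  unfold noiseSum
  rw [integral_finsetSum _ fun j _ => integrable_finsetSum _ fun _ _ =>
    integrable_exp_lin_eval _ _ j]
  have h : ∀ j : Fin (M - 1), ∫ v : Fin (M - 1) → ℂ, ∑ b ∈ Finset.Icc 1 K,
      exp (√c * lin (psk K b) (v j)) ∂(Measure.pi fun _ => complexGaussian 2) =
        K * exp (c / 2) := by
    intro j
    rw [integral_finsetSum _ fun b _ => integrable_exp_lin_eval _ _ j]
    simp only [integral_exp_lin_eval, sq_sqrt hc.le, normSq_psk, mul_one, Finset.sum_const,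
      Nat.card_Icc, Nat.add_sub_cancel, nsmul_eq_mul]
  simp only [h, Finset.sum_const, Finset.card_univ, Fintype.card_fin, nsmul_eq_mul]

/-- Averaging the noise first, inside the minimum, leaves a one-dimensional Gaussian integral. -/
lemma integral_min_one_noise_le {K M : ℕ} (hK : 1 ≤ K) (hM : 1 ≤ M) {c : ℝ} (hc : 0 < c) :
    ∫ U, min 1 (noiseSum K (M := M) c U.2 / sig c 1 U.1) ∂noiseLaw M ≤
      ∫ x, min 1 (exp (√c * (x - (c / 2 - log (K * M)) / √c))) ∂gaussianReal 0 1 := by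
  have hm : ∀ U : ℂ × (Fin (M - 1) → ℂ),
      0 ≤ min 1 (noiseSum K (M := M) c U.2 / sig c 1 U.1) := fun U =>
    le_min zero_le_one (div_nonneg (noiseSum_nonneg _ _ _) (sig_pos _ _ _).le)
  have hcont : Continuous fun U : ℂ × (Fin (M - 1) → ℂ) =>
      min 1 (noiseSum K (M := M) c U.2 / sig c 1 U.1) :=
    continuous_const.min (Continuous.div (by fun_prop) (by fun_prop) fun U => (sig_pos _ _ _).ne')
  have hint : Integrable (fun U : ℂ × (Fin (M - 1) → ℂ) =>
      min 1 (noiseSum K (M := M) c U.2 / sig c 1 U.1)) (noiseLaw M) :=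
    .of_bound hcont.aestronglyMeasurable 1 (Eventually.of_forall fun U => by
      rw [norm_eq_abs, abs_of_nonneg (hm U)]; exact min_le_left _ _)
  have hKM : (0 : ℝ) < K * M := by positivity
  have hs0 : 0 < √c := sqrt_pos.mpr hc
  set G : ℝ → ℝ := fun x => min 1 (exp (√c * (x - (c / 2 - log (K * M)) / √c))) with hG
  have hGcont : Continuous G := by rw [hG]; fun_prop
  have hG1 : ∀ x, ‖G x‖ ≤ 1 := fun x => by
    rw [norm_eq_abs, abs_of_nonneg (le_min zero_le_one (exp_pos _).le)]; exact min_le_left _ _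
  rw [noiseLaw, integral_prod _ hint]
  have hsymm : ∫ x, G x ∂gaussianReal 0 1 = ∫ x, G (-x) ∂gaussianReal 0 1 := by
    conv_lhs => rw [← neg_zero, ← gaussianReal_map_neg (μ := 0) (v := 1)]
    exact integral_map (by fun_prop) hGcont.aestronglyMeasurable
  rw [hsymm, ← integral_comp_re (f := fun x => G (-x)) (by fun_prop)]
  refine integral_mono_of_nonneg (Eventually.of_forall fun z => integral_nonneg fun v => hm (z, v))
    (.of_bound (by fun_prop) 1 (Eventually.of_forall fun z => hG1 _))
    (Eventually.of_forall fun z => ?_)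
  have hpos := sig_pos c 1 z
  have hi := (integrable_noiseSum K M c).div_const (sig c 1 z)
  have hzint : Integrable (fun v : Fin (M - 1) → ℂ => min 1 (noiseSum K (M := M) c v / sig c 1 z))
      (Measure.pi fun _ => complexGaussian 2) := (integrable_const _).inf hi
  refine le_min ?_ ?_
  · calc _ ≤ ∫ _ : Fin (M - 1) → ℂ, (1 : ℝ) ∂(Measure.pi fun _ => complexGaussian 2) :=
          integral_mono hzint (integrable_const _) fun v => min_le_left _ _
      _ = 1 := by simp
  · calc _ ≤ ∫ v : Fin (M - 1) → ℂ, noiseSum K (M := M) c v / sig c 1 z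
            ∂(Measure.pi fun _ => complexGaussian 2) :=
          integral_mono hzint hi fun v => min_le_right _ _
      _ = ((M - 1 : ℕ) : ℝ) * (K * exp (c / 2)) / sig c 1 z := by
          rw [integral_div, integral_noiseSum K M hc]
      _ ≤ K * M * exp (c / 2) / sig c 1 z := by
          gcongr ?_ / _
          have : ((M - 1 : ℕ) : ℝ) ≤ M := by exact_mod_cast Nat.sub_le M 1
          calc ((M - 1 : ℕ) : ℝ) * (K * exp (c / 2)) ≤ M * (K * exp (c / 2)) := by gcongr
            _ = _ := by ring
      _ = exp (√c * (-z.re - (c / 2 - log (K * M)) / √c)) := by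
          nth_rewrite 1 [← exp_log hKM]
          rw [sig, ← exp_add, ← exp_sub, lin_one, Complex.one_re, mul_sub, mul_div_cancel₀ _ hs0.ne']
          congr 1; ring

lemma one_sub_ratio_le {K : ℕ} (hK : 1 ≤ K) (M : ℕ) (c : ℝ) (U : ℂ × (Fin (M - 1) → ℂ)) :
    1 - ratio K M c U ≤ min 1 (noiseSum K (M := M) c U.2 / sig c 1 U.1) + cross K c U.1 := by
  have hS := sigSum_pos hK c U.1
  have hN := noiseSum_nonneg K c U.2
  have hsig := sig_pos c 1 U.1
  have hle : sig c 1 U.1 ≤ sigSum K c U.1 := by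
    have := sig_le_sigSum (Finset.mem_Icc.mpr ⟨hK, le_rfl⟩) c U.1
    rwa [psk_self hK] at this
  have hd := abs_le.mp (abs_sigNum_le K c U.1)
  have h1 : 1 - ratio K M c U = noiseSum K c U.2 / (sigSum K c U.1 + noiseSum K c U.2) +
      (sigSum K c U.1 - sigNum K c U.1) / (sigSum K c U.1 + noiseSum K c U.2) := by
    rw [ratio]
    have : sigSum K c U.1 + noiseSum K c U.2 ≠ 0 := by linarith
    field_simp
    ring
  rw [h1, cross_eq]
  refine add_le_add (le_min ?_ ?_) ?_
  · rw [div_le_one (by linarith)]; linarith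
  · exact div_le_div_of_nonneg_left hN hsig (by linarith)
  · exact div_le_div_of_nonneg_left (by linarith) hS (by linarith)

lemma one_sub_scriptE_le_integral {K M : ℕ} (hK : 1 ≤ K) (hM : 1 ≤ M) {c g : ℝ} (hc : 0 < c)
    (hg : PhaseGap K g) :
    1 - scriptE K M (1 / c) ≤
      ∫ x, min 1 (exp (√c * (x - (c / 2 - log (K * M)) / √c))) ∂gaussianReal 0 1 +
        2 * ((K : ℝ) - 1) * exp (-(c * g / 2)) := by
  have hcont : Continuous fun U : ℂ × (Fin (M - 1) → ℂ) =>
      min 1 (noiseSum K (M := M) c U.2 / sig c 1 U.1) :=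
    continuous_const.min (Continuous.div (by fun_prop) (by fun_prop) fun U => (sig_pos _ _ _).ne')
  have hint : Integrable (fun U : ℂ × (Fin (M - 1) → ℂ) =>
      min 1 (noiseSum K (M := M) c U.2 / sig c 1 U.1)) (noiseLaw M) :=
    .of_bound hcont.aestronglyMeasurable 1 (Eventually.of_forall fun U => by
      rw [norm_eq_abs, abs_of_nonneg
        (le_min zero_le_one (div_nonneg (noiseSum_nonneg _ _ _) (sig_pos _ _ _).le))]
      exact min_le_left _ _)
  have hcross := integrable_noiseLaw_fst M (integrable_cross hK c)
  refine (one_sub_scriptE_le hK M hc (G := fun U => min 1 (noiseSum K (M := M) c U.2 / sig c 1 U.1) +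
    cross K c U.1) (hint.add hcross) fun U => one_sub_ratio_le hK M c U).trans ?_
  rw [integral_add hint hcross, integral_noiseLaw_fst]
  exact add_le_add (integral_min_one_noise_le hK hM hc) (integral_cross_le hK hc hg)

/-- Above the threshold, `c / 2` exceeds `log (K M)` and `1 - scriptE` is exponentially small. -/
lemma one_sub_scriptE_le_exp {K M : ℕ} (hK : 1 ≤ K) (hM : 1 ≤ M) {c g : ℝ} (hc : 0 < c)
    (hg : PhaseGap K g) (hL : 0 ≤ log (K * M)) (hcL : 2 * log (K * M) ≤ c) :
    1 - scriptE K M (1 / c) ≤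
      exp (-(((c / 2 - log (K * M)) / √c) ^ 2 / 2)) * (1 / 2 + 1 / √c) +
        2 * ((K : ℝ) - 1) * exp (-(c * g / 2)) := by
  have hs0 : 0 < √c := sqrt_pos.mpr hc
  refine (one_sub_scriptE_le_integral hK hM hc hg).trans (add_le_add_left
    (integral_min_one_exp_le hs0 (div_nonneg (by linarith) hs0.le) ?_) _)
  rw [div_le_iff₀ hs0, div_mul_eq_mul_div, mul_self_sqrt hc.le]
  linarith

/-- At every noise level, `1 - scriptE` exceeds `1` by at most an exponentially small quantity,
which vanishes for `K = 1`. -/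
lemma one_sub_scriptE_le_one_add {K M : ℕ} (hK : 1 ≤ K) (hM : 1 ≤ M) {c g : ℝ} (hc : 0 < c)
    (hg : PhaseGap K g) :
    1 - scriptE K M (1 / c) ≤ 1 + 2 * ((K : ℝ) - 1) * exp (-(c * g / 2)) := by
  refine (one_sub_scriptE_le_integral hK hM hc hg).trans (add_le_add_left ?_ _)
  calc _ ≤ ∫ _, (1 : ℝ) ∂gaussianReal 0 1 :=
        integral_mono_of_nonneg (Eventually.of_forall fun x => le_min zero_le_one (exp_pos _).le)
          (integrable_const _) (Eventually.of_forall fun x => min_le_left _ _)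
    _ = 1 := by simp

lemma sigNum_nonneg_of_even (m : ℕ) {c : ℝ} (hc : 0 < c) {z : ℂ} (hz : -√c ≤ z.re) :
    0 ≤ sigNum (2 * m) c z := by
  have hA : 0 ≤ c + √c * z.re := by
    have := mul_self_sqrt hc.le
    nlinarith [sqrt_nonneg c]
  refine (sum_psk_re_mul_exp_nonneg m hA (√c * z.im)).trans_eq ?_
  refine Finset.sum_congr rfl fun k _ => ?_
  rw [sig, lin_eq]
  congr 2; ring

/-- For even `K` the integrand is non-negative unless the noise reverses the sign of the real part
of the signal. -/
lemma one_sub_scriptE_le_of_even {m M : ℕ} (hm : 1 ≤ m) {c : ℝ} (hc : 0 < c) :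
    1 - scriptE (2 * m) M (1 / c) ≤ 1 + exp (-(c / 2)) / √(2 * π * c) := by
  have hK : 1 ≤ 2 * m := by omega
  have hs0 : 0 < √c := sqrt_pos.mpr hc
  have hi : Integrable (fun z : ℂ => (Set.Iio (-√c)).indicator (fun _ => (1 : ℝ)) z.re)
      (complexGaussian 2) := by
    refine .of_bound ?_ 1 (Eventually.of_forall fun z => ?_)
    · exact ((measurable_const.indicator measurableSet_Iio).comp
        Complex.measurable_re).aestronglyMeasurable
    · rw [norm_eq_abs, abs_of_nonneg (Set.indicator_nonneg (fun _ _ => zero_le_one) _)]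
      exact Set.indicator_le_self' (fun _ _ => zero_le_one) _
  have hb : ∀ U, 1 - ratio (2 * m) M c U ≤
      1 + (Set.Iio (-√c)).indicator (fun _ => (1 : ℝ)) U.1.re := by
    intro U
    by_cases h : U.1.re < -√c
    · rw [Set.indicator_of_mem (by exact h)]
      linarith [(abs_le.mp (abs_ratio_le hK M c U)).1]
    · rw [Set.indicator_of_notMem (by simpa using h)]
      have h1 := sigNum_nonneg_of_even m hc (not_lt.mp h)
      have h2 : 0 ≤ ratio (2 * m) M c U := div_nonneg h1
        (by linarith [sigSum_pos hK c U.1, noiseSum_nonneg (2 * m) c U.2])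
      linarith
  refine (one_sub_scriptE_le hK M hc
    (G := fun U => 1 + (Set.Iio (-√c)).indicator (fun _ => (1 : ℝ)) U.1.re)
    ((integrable_const _).add (integrable_noiseLaw_fst M hi)) hb).trans ?_
  rw [integral_add (integrable_const _) (integrable_noiseLaw_fst M hi),
    integral_noiseLaw_fst M (fun z => (Set.Iio (-√c)).indicator (fun _ => (1 : ℝ)) z.re),
    integral_comp_re (measurable_const.indicator measurableSet_Iio),
    integral_indicator measurableSet_Iio]
  simp only [integral_const, probReal_univ, smul_eq_mul, mul_one, measureReal_restrict_apply_univ]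
  rw [gaussian_Iio_neg]
  have := gaussian_Ioi_le hs0
  rw [sq_sqrt hc.le, ← sqrt_mul (by positivity)] at this
  linarith

/-! ### An upper bound for `scriptE` -/

lemma ratio_le {K : ℕ} (hK : 1 ≤ K) (M : ℕ) (c y : ℝ) (U : ℂ × (Fin (M - 1) → ℂ)) :
    ratio K M c U ≤ (Set.univ.pi fun _ => Complex.re ⁻¹' Set.Iio y).indicator (fun _ => (1 : ℝ)) U.2 +
      ∑ k ∈ Finset.Icc 1 K, min 1 (sig c (psk K k) U.1 * exp (-(√c * y))) := by
  have hsum : 0 ≤ ∑ k ∈ Finset.Icc 1 K, min 1 (sig c (psk K k) U.1 * exp (-(√c * y))) :=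
    Finset.sum_nonneg fun k _ =>
      le_min zero_le_one (mul_nonneg (sig_pos _ _ _).le (exp_pos _).le)
  by_cases h : U.2 ∈ Set.univ.pi fun _ => Complex.re ⁻¹' Set.Iio y
  · rw [Set.indicator_of_mem h]
    linarith [(abs_le.mp (abs_ratio_le hK M c U)).2]
  · rw [Set.indicator_of_notMem h, zero_add]
    simp only [Set.mem_pi, Set.mem_univ, Set.mem_preimage, Set.mem_Iio, true_imp_iff, not_forall,
      not_lt] at h
    obtain ⟨j, hj⟩ := h
    have hN : exp (√c * y) ≤ noiseSum K c U.2 := by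
      calc exp (√c * y) ≤ exp (√c * lin (psk K K) (U.2 j)) := by
            rw [psk_self hK, lin_one]
            exact exp_le_exp.mpr (mul_le_mul_of_nonneg_left hj (sqrt_nonneg c))
        _ ≤ ∑ b ∈ Finset.Icc 1 K, exp (√c * lin (psk K b) (U.2 j)) :=
            Finset.single_le_sum (f := fun b => exp (√c * lin (psk K b) (U.2 j)))
              (fun _ _ => (exp_pos _).le) (Finset.mem_Icc.mpr ⟨hK, le_rfl⟩)
        _ ≤ _ := Finset.single_le_sum
              (f := fun j => ∑ b ∈ Finset.Icc 1 K, exp (√c * lin (psk K b) (U.2 j)))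
              (fun _ _ => Finset.sum_nonneg fun _ _ => (exp_pos _).le) (Finset.mem_univ j)
    have hS := sigSum_pos hK c U.1
    have hD : 0 < sigSum K c U.1 + noiseSum K c U.2 := by linarith [exp_pos (√c * y)]
    calc ratio K M c U ≤ sigSum K c U.1 / (sigSum K c U.1 + noiseSum K c U.2) := by
          unfold ratio
          gcongr
          exact (abs_le.mp (abs_sigNum_le K c U.1)).2
      _ = ∑ k ∈ Finset.Icc 1 K, sig c (psk K k) U.1 / (sigSum K c U.1 + noiseSum K c U.2) := by
          rw [← Finset.sum_div, sigSum]
      _ ≤ _ := by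
          refine Finset.sum_le_sum fun k hk => le_min ?_ ?_
          · rw [div_le_one hD]
            linarith [sig_le_sigSum hk c U.1, noiseSum_nonneg K c U.2]
          · rw [exp_neg, ← div_eq_mul_inv]
            exact div_le_div_of_nonneg_left (sig_pos _ _ _).le (exp_pos _) (by linarith)

/-- The probability that the real parts of all the noise terms stay below `y`. -/
lemma pi_all_lt_le (n : ℕ) (y : ℝ) :
    (Measure.pi fun _ : Fin n => complexGaussian 2).real
      (Set.univ.pi fun _ => Complex.re ⁻¹' Set.Iio y) ≤
        exp (-(n * (gaussianReal 0 1).real (Set.Ici y))) := by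
  have h1 : (complexGaussian 2).real (Complex.re ⁻¹' Set.Iio y) =
      1 - (gaussianReal 0 1).real (Set.Ici y) := by
    rw [← map_measureReal_apply Complex.measurable_re measurableSet_Iio, complexGaussian_map_re,
      ← Set.compl_Ici, probReal_compl_eq_one_sub measurableSet_Ici]
  rw [measureReal_def, Measure.pi_pi, ENNReal.toReal_prod]
  simp only [← measureReal_def, h1, Finset.prod_const, Finset.card_univ, Fintype.card_fin]
  calc (1 - (gaussianReal 0 1).real (Set.Ici y)) ^ n
      ≤ exp (-(gaussianReal 0 1).real (Set.Ici y)) ^ n :=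
        pow_le_pow_left₀ (by linarith [measureReal_le_one (μ := gaussianReal 0 1) (s := Set.Ici y)])
          (one_sub_le_exp_neg _) n
    _ = _ := by rw [← exp_nat_mul]; congr 1; ring

lemma integral_min_one_sig_le {c g y : ℝ} {p : ℂ} (hc : 0 < c) (hg0 : 0 ≤ g) (hg1 : g ≤ 1)
    (hp : Complex.normSq p = 1) (hre : 2 * g ≤ 1 - p.re) (hy : √c - g * √c / 4 ≤ y) :
    ∫ z, min 1 (sig c p z * exp (-(√c * y))) ∂complexGaussian 2 ≤ exp (-(g ^ 2 * c)) := by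
  have hs := mul_self_sqrt hc.le
  have hs0 : 0 < √c := sqrt_pos.mpr hc
  have hb : c * p.re - √c * y ≤ -(3 / 2 * (g * c)) := by nlinarith
  calc _ ≤ ∫ z, exp (-(3 / 2 * (g ^ 2 * c))) * exp (g * √c * lin p z) ∂complexGaussian 2 := by
        refine integral_mono_of_nonneg (Eventually.of_forall fun z => le_min zero_le_one
          (mul_nonneg (sig_pos _ _ _).le (exp_pos _).le)) ((integrable_exp_lin _ _).const_mul _)
          (Eventually.of_forall fun z => ?_)
        beta_reduce
        rw [sig, ← exp_add, ← exp_add]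
        set e := c * p.re + √c * lin p z + -(√c * y) with he
        have h2 : g * e ≤ -(3 / 2 * (g ^ 2 * c)) + g * √c * lin p z := by
          have := mul_le_mul_of_nonneg_left hb hg0
          rw [he]; linarith
        refine le_trans ?_ (exp_le_exp.mpr h2)
        rcases le_total e 0 with h | h
        · exact (min_le_right _ _).trans (exp_le_exp.mpr (by nlinarith))
        · exact (min_le_left _ _).trans (one_le_exp (mul_nonneg hg0 h))
    _ = exp (-(g ^ 2 * c)) := by
        rw [integral_const_mul, integral_exp_lin, hp, ← exp_add, mul_pow, sq_sqrt hc.le]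
        congr 1; ring

lemma scriptE_le_integral {K : ℕ} (hK : 1 ≤ K) (M : ℕ) {c g y : ℝ} (hc : 0 < c) (hg0 : 0 ≤ g)
    (hg1 : g ≤ 1) (hg : PhaseGap K g) (hy : √c - g * √c / 4 ≤ y) :
    scriptE K M (1 / c) ≤
      exp (-((M - 1 : ℕ) * (gaussianReal 0 1).real (Set.Ici y))) + K * exp (-(g ^ 2 * c)) +
        ∫ x, min 1 (exp (√c * (x - (y - √c)))) ∂gaussianReal 0 1 := by
  have hKmem : K ∈ Finset.Icc 1 K := Finset.mem_Icc.mpr ⟨hK, le_rfl⟩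
  have hm : MeasurableSet (Set.univ.pi fun _ : Fin (M - 1) => Complex.re ⁻¹' Set.Iio y) :=
    MeasurableSet.univ_pi fun _ => Complex.measurable_re measurableSet_Iio
  have hi1 : Integrable ((Set.univ.pi fun _ : Fin (M - 1) => Complex.re ⁻¹' Set.Iio y).indicator
      fun _ => (1 : ℝ)) (Measure.pi fun _ => complexGaussian 2) :=
    (integrable_const _).indicator hm
  have hi1' : Integrable (fun U : ℂ × (Fin (M - 1) → ℂ) =>
      (Set.univ.pi fun _ : Fin (M - 1) => Complex.re ⁻¹' Set.Iio y).indicator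
        (fun _ => (1 : ℝ)) U.2) (noiseLaw M) := hi1.comp_snd _
  have hi2 : ∀ k, Integrable (fun z => min 1 (sig c (psk K k) z * exp (-(√c * y))))
      (complexGaussian 2) := fun k => by
    refine .of_bound (by fun_prop) 1 (Eventually.of_forall fun z => ?_)
    rw [norm_eq_abs, abs_of_nonneg
      (le_min zero_le_one (mul_nonneg (sig_pos _ _ _).le (exp_pos _).le))]
    exact min_le_left _ _
  have hi2' : Integrable (fun U : ℂ × (Fin (M - 1) → ℂ) =>
      ∑ k ∈ Finset.Icc 1 K, min 1 (sig c (psk K k) U.1 * exp (-(√c * y)))) (noiseLaw M) :=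
    integrable_finsetSum _ fun k _ => integrable_noiseLaw_fst M (hi2 k)
  rw [scriptE_eq K M hc]
  calc ∫ U, ratio K M c U ∂noiseLaw M
      ≤ ∫ U : ℂ × (Fin (M - 1) → ℂ), ((Set.univ.pi fun _ => Complex.re ⁻¹' Set.Iio y).indicator
          (fun _ => (1 : ℝ)) U.2 + ∑ k ∈ Finset.Icc 1 K,
            min 1 (sig c (psk K k) U.1 * exp (-(√c * y)))) ∂noiseLaw M :=
        integral_mono (integrable_ratio hK M c) (hi1'.add hi2') fun U => ratio_le hK M c y U
    _ = (Measure.pi fun _ : Fin (M - 1) => complexGaussian 2).real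
          (Set.univ.pi fun _ => Complex.re ⁻¹' Set.Iio y) +
        ∑ k ∈ Finset.Icc 1 K, ∫ z, min 1 (sig c (psk K k) z * exp (-(√c * y)))
          ∂complexGaussian 2 := by
        rw [integral_add hi1' hi2']
        congr 1
        · rw [noiseLaw, integral_fun_snd, integral_indicator hm]
          simp
        · rw [integral_noiseLaw_fst M (fun z => ∑ k ∈ Finset.Icc 1 K,
            min 1 (sig c (psk K k) z * exp (-(√c * y)))), integral_finsetSum _ fun k _ => hi2 k]
    _ ≤ _ := ?_
  rw [← Finset.add_sum_erase _ _ hKmem, add_assoc, add_comm (∫ z, _ ∂_)]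
  refine add_le_add (pi_all_lt_le _ _) (add_le_add ?_ (le_of_eq ?_))
  · calc _ ≤ ∑ k ∈ (Finset.Icc 1 K).erase K, exp (-(g ^ 2 * c)) :=
          Finset.sum_le_sum fun k hk => integral_min_one_sig_le hc hg0 hg1 (normSq_psk K k)
            (hg k (Finset.mem_of_mem_erase hk) (Finset.ne_of_mem_erase hk)) hy
      _ ≤ ∑ k ∈ Finset.Icc 1 K, exp (-(g ^ 2 * c)) :=
          Finset.sum_le_sum_of_subset_of_nonneg (Finset.erase_subset _ _)
            fun _ _ _ => (exp_pos _).le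
      _ = _ := by simp
  · rw [← integral_comp_re (f := fun x => min 1 (exp (√c * (x - (y - √c))))) (by fun_prop)]
    congr 1
    funext z
    rw [psk_self hK, sig, lin_one, ← exp_add, Complex.one_re]
    congr 2
    nth_rewrite 1 [← mul_self_sqrt hc.le]
    ring

/-! ### Asymptotics in the section size -/

lemma tendsto_log_mul_atTop {K : ℕ} (hK : 1 ≤ K) :
    Tendsto (fun M : ℕ => log ((K : ℝ) * M)) atTop atTop := by
  have hK' : (0 : ℝ) < K := by exact_mod_cast hK
  exact tendsto_log_atTop.comp (tendsto_natCast_atTop_atTop.const_mul_atTop hK')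

lemma tendsto_mul_exp_neg_mul {b : ℝ} (hb : 0 < b) (C : ℝ) :
    Tendsto (fun x => C * (x * exp (-(b * x)))) atTop (𝓝 0) := by
  have h := (tendsto_rpow_mul_exp_neg_mul_atTop_nhds_zero 1 b hb).const_mul C
  simpa only [rpow_one, neg_mul, mul_zero] using h

lemma eventually_forall_mul {P : ℝ → Prop} (h : ∀ᶠ c in atTop, P c) {lo : ℝ} (hlo : 0 < lo) :
    ∀ᶠ L in atTop, ∀ ν, lo ≤ ν → P (ν * L) := by
  obtain ⟨c₀, hc⟩ := eventually_atTop.mp h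
  filter_upwards [eventually_ge_atTop (c₀ / lo), eventually_ge_atTop 0] with L hL hL0 ν hν
  refine hc _ ?_
  rw [div_le_iff₀ hlo] at hL
  nlinarith

lemma rpow_eq_exp_log {K M : ℕ} (hK : 1 ≤ K) (hM : 1 ≤ M) (x : ℝ) :
    ((K : ℝ) * M) ^ x = exp (log (K * M) * x) :=
  rpow_def_of_pos (by positivity) x

lemma mul_exp_neg_sq_le (s : ℝ) : s * exp (-(49 / 1000 * s ^ 2)) ≤ 194 / 100 := by
  refine abs_le_of_sq_le_sq' ?_ (by norm_num) |>.2
  rw [mul_pow, ← exp_nat_mul]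
  have h1 : 98 / 1000 * s ^ 2 ≤ exp (98 / 1000 * s ^ 2 - 1) := by
    linarith [add_one_le_exp (98 / 1000 * s ^ 2 - 1)]
  have h2 : exp (98 / 1000 * s ^ 2 - 1) * exp ((2 : ℕ) * -(49 / 1000 * s ^ 2)) = (exp 1)⁻¹ := by
    rw [← exp_add, ← exp_neg]; congr 1; push_cast; ring
  have h3 : (exp 1)⁻¹ ≤ 1 / 2.718 := by
    rw [← one_div]
    exact one_div_le_one_div_of_le (by norm_num) (by linarith [exp_one_gt_d9])
  have h4 := mul_le_mul_of_nonneg_right h1 (exp_pos ((2 : ℕ) * -(49 / 1000 * s ^ 2))).le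
  rw [h2] at h4
  norm_num at h3 h4 ⊢
  linarith

/-- The bound `exp (-u² / 2) / 2` for the Gaussian tail at `u ≈ δ √L / √10` beats
`exp (-κ δ² L) / (δ √L)` with a margin, which absorbs all the lower-order terms for large `L`. -/
lemma eventually_above_threshold (C : ℝ) {g : ℝ} (hC : 0 ≤ C) (hg0 : 0 < g) (hg1 : g ≤ 1) :
    ∀ᶠ L in atTop, ∀ δ ∈ Set.Ioo (0 : ℝ) (1 / 2), ∀ ν, 2 + δ < ν →
      exp (-(((ν * L / 2 - L) / √(ν * L)) ^ 2 / 2)) * (1 / 2 + 1 / √(ν * L)) +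
        C * exp (-(ν * L * g / 2)) ≤ exp (L * -(g / 1000 * δ ^ 2)) / (δ * √L) := by
  have ht := (tendsto_mul_exp_neg_mul (half_pos hg0) C).eventually_le_const
    (by norm_num : (0 : ℝ) < 2 / 100)
  filter_upwards [ht, eventually_ge_atTop (40000 : ℝ)] with L hL2 hL δ hδ ν hν
  obtain ⟨hδ0, hδ1⟩ := hδ
  have hL0 : 0 < L := by linarith
  have hν0 : 0 < ν := by linarith
  have hsL : 200 ≤ √L := le_sqrt_of_sq_le (by linarith)
  have hsL0 : 0 < √L := by linarith
  have hsq : √L ^ 2 = L := sq_sqrt hL0.le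
  set s := δ * √L with hs
  have hs0 : 0 < s := by positivity
  have hs2 : s ^ 2 = δ ^ 2 * L := by rw [hs, mul_pow, hsq]
  rw [le_div_iff₀ hs0]
  have h1 : exp (-(((ν * L / 2 - L) / √(ν * L)) ^ 2 / 2)) ≤ exp (-(s ^ 2 / 20)) := by
    refine exp_le_exp.mpr ?_
    rw [div_pow, sq_sqrt (by positivity), hs2]
    have : δ ^ 2 * L / 10 ≤ (ν * L / 2 - L) ^ 2 / (ν * L) := by
      rw [le_div_iff₀ (by positivity)]
      have : δ ^ 2 * ν / 10 ≤ (ν / 2 - 1) ^ 2 := by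
        obtain ⟨d, hd, rfl⟩ : ∃ d, 0 < d ∧ ν = 2 + δ + d := ⟨ν - 2 - δ, by linarith, by ring⟩
        nlinarith [mul_pos hδ0 hd, mul_pos hδ0 hδ0, mul_pos (mul_pos hδ0 hδ0) (sub_pos.mpr hδ1),
          mul_pos (mul_pos hδ0 hd) (sub_pos.mpr hδ1)]
      have := mul_le_mul_of_nonneg_right this (sq_nonneg L)
      linarith
    linarith
  have h2 : 1 / √(ν * L) ≤ 5 / 1000 := by
    have : √L ≤ √(ν * L) := sqrt_le_sqrt (by nlinarith)
    calc 1 / √(ν * L) ≤ 1 / 200 := one_div_le_one_div_of_le (by norm_num) (by linarith)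
      _ = _ := by norm_num
  have h3 : exp (-(ν * L * g / 2)) ≤ exp (-(g * L)) := by
    refine exp_le_exp.mpr ?_
    have := mul_pos hL0 hg0
    nlinarith
  have hT : 0 < exp (L * (g / 1000 * δ ^ 2)) := exp_pos _
  have hTi : exp (L * -(g / 1000 * δ ^ 2)) = (exp (L * (g / 1000 * δ ^ 2)))⁻¹ := by
    rw [← exp_neg]; congr 1; ring
  rw [hTi, ← one_div, le_div_iff₀ hT]
  have h4 : exp (-(s ^ 2 / 20)) * s * exp (L * (g / 1000 * δ ^ 2)) ≤ 194 / 100 := by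
    refine le_trans ?_ (mul_exp_neg_sq_le s)
    rw [mul_right_comm, ← exp_add, mul_comm]
    gcongr
    have : 0 ≤ (1 - g) * s ^ 2 := mul_nonneg (by linarith) (sq_nonneg s)
    rw [hs2] at this ⊢
    linarith
  have h5 : C * exp (-(g * L)) * s * exp (L * (g / 1000 * δ ^ 2)) ≤ 2 / 100 := by
    refine le_trans ?_ hL2
    have hsL' : s ≤ L := by nlinarith
    calc _ = C * (s * (exp (-(g * L)) * exp (L * (g / 1000 * δ ^ 2)))) := by ring
      _ ≤ C * (L * exp (-(g / 2 * L))) := by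
        rw [← exp_add]
        gcongr
        have h6 : δ ^ 2 ≤ 1 := by nlinarith
        have := mul_le_mul_of_nonneg_left h6 (mul_pos hL0 hg0).le
        nlinarith [mul_pos hL0 hg0]
  calc _ ≤ (exp (-(s ^ 2 / 20)) * (1 / 2 + 5 / 1000) + C * exp (-(g * L))) * s *
        exp (L * (g / 1000 * δ ^ 2)) := by gcongr
    _ = exp (-(s ^ 2 / 20)) * s * exp (L * (g / 1000 * δ ^ 2)) * (505 / 1000) +
        C * exp (-(g * L)) * s * exp (L * (g / 1000 * δ ^ 2)) := by ring
    _ ≤ 194 / 100 * (505 / 1000) + 2 / 100 := by gcongr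
    _ ≤ 1 := by norm_num

lemma eventually_one_sub_scriptE_le_fBound {K : ℕ} (hK : 1 ≤ K) {g : ℝ} (hg0 : 0 < g) (hg1 : g ≤ 1)
    (hg : PhaseGap K g) :
    ∀ᶠ M : ℕ in atTop, ∀ δ ∈ Set.Ioo (0 : ℝ) (1 / 2), ∀ ν, 2 + δ < ν →
      1 - scriptE K M (1 / (ν * log (K * M))) ≤ fBound (g / 1000) K M δ := by
  have hK1 : (0 : ℝ) ≤ 2 * ((K : ℝ) - 1) := by
    have : (1 : ℝ) ≤ K := by exact_mod_cast hK
    linarith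
  filter_upwards [(tendsto_log_mul_atTop hK).eventually
    (eventually_above_threshold _ hK1 hg0 hg1), eventually_ge_atTop 1,
    (tendsto_log_mul_atTop hK).eventually (eventually_gt_atTop 0)] with M hM hM1 hL δ hδ ν hν
  have hν0 : 2 ≤ ν := by linarith [hδ.1]
  rw [fBound, rpow_eq_exp_log hK hM1]
  exact (one_sub_scriptE_le_exp hK hM1 (by positivity) hg hL.le (by nlinarith)).trans (hM δ hδ ν hν)

lemma eventually_mul_exp_le_hBound {K : ℕ} (hK : 1 ≤ K) {C a b lo : ℝ} (hC : 0 ≤ C) (hab : a < b)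
    (hlo : 0 < lo) :
    ∀ᶠ M : ℕ in atTop, ∀ ν, lo ≤ ν →
      C * exp (-(b * (ν * log (K * M)))) ≤ hBound a K M ν := by
  have h1 : ∀ᶠ c : ℝ in atTop, C * exp (-(b * c)) ≤ exp (-(a * c)) / √c := by
    filter_upwards [(tendsto_mul_exp_neg_mul (sub_pos.mpr hab) C).eventually_le_const one_pos,
      eventually_ge_atTop 1] with c hc hc1
    have hs : 0 < √c := sqrt_pos.mpr (by linarith)
    have hsc : √c ≤ c := sqrt_le_iff.mpr ⟨by linarith, by nlinarith⟩
    rw [le_div_iff₀ hs]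
    calc C * exp (-(b * c)) * √c ≤ C * exp (-(b * c)) * c := by gcongr
      _ = C * (c * exp (-((b - a) * c))) * exp (-(a * c)) := by
          have : exp (-(b * c)) = exp (-((b - a) * c)) * exp (-(a * c)) := by
            rw [← exp_add]; congr 1; ring
          rw [this]; ring
      _ ≤ 1 * exp (-(a * c)) := by gcongr
      _ = _ := one_mul _
  filter_upwards [(tendsto_log_mul_atTop hK).eventually (eventually_forall_mul h1 hlo),
    eventually_ge_atTop 1] with M hM hM1 ν hν
  rw [hBound, rpow_eq_exp_log hK hM1]
  convert hM ν hν using 3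
  ring

lemma tendsto_fBound {K : ℕ} (hK : 1 ≤ K) {a δ : ℝ} (ha : 0 < a) (hδ : 0 < δ) :
    Tendsto (fun M => fBound a K M δ) atTop (𝓝 0) := by
  have h1 : Tendsto (fun M : ℕ => 1 / δ * (√(log ((K : ℝ) * M)))⁻¹) atTop (𝓝 0) := by
    simpa using ((tendsto_sqrt_atTop.comp (tendsto_log_mul_atTop hK)).inv_tendsto_atTop).const_mul
      (1 / δ)
  refine squeeze_zero' (Eventually.of_forall fun M => ?_) ?_ h1
  · unfold fBound; positivity
  · filter_upwards [eventually_ge_atTop 1,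
      (tendsto_log_mul_atTop hK).eventually (eventually_gt_atTop 0)] with M hM hL
    rw [fBound, rpow_eq_exp_log hK hM, ← one_div, div_mul_div_comm, one_mul]
    gcongr
    exact exp_le_one_iff.mpr (by rw [mul_neg]; exact neg_nonpos.mpr (by positivity))

lemma tendsto_hBound {K : ℕ} (hK : 1 ≤ K) {a lo : ℝ} (ha : 0 < a) (hlo : 0 < lo) {ν : ℕ → ℝ}
    (hν : ∀ M, lo ≤ ν M) : Tendsto (fun M => hBound a K M (ν M)) atTop (𝓝 0) := by
  have h1 : Tendsto (fun M : ℕ => (√(lo * log ((K : ℝ) * M)))⁻¹) atTop (𝓝 0) :=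
    (tendsto_sqrt_atTop.comp ((tendsto_log_mul_atTop hK).const_mul_atTop hlo)).inv_tendsto_atTop
  refine squeeze_zero' (Eventually.of_forall fun M => ?_) ?_ h1
  · unfold hBound; positivity
  · filter_upwards [eventually_ge_atTop 1,
      (tendsto_log_mul_atTop hK).eventually (eventually_gt_atTop 0)] with M hM hL
    have := hν M
    have hν0 : 0 < ν M := hlo.trans_le this
    rw [hBound, rpow_eq_exp_log hK hM, ← one_div]
    gcongr
    exact exp_le_one_iff.mpr (by rw [mul_neg]; exact neg_nonpos.mpr (by positivity))

/-! ### Below the threshold -/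

/-- Among `M` Gaussians, one exceeds `√(2 log (K M)) - 1 / 10` with overwhelming probability. -/
lemma eventually_log_le_mul_gaussian_Ici {K : ℕ} (hK : 1 ≤ K) :
    ∀ᶠ M : ℕ in atTop, log ((K : ℝ) * M) ≤
      (M - 1 : ℕ) * (gaussianReal 0 1).real (Set.Ici (√(2 * log (K * M)) - 1 / 10)) := by
  have hKpos : (0 : ℝ) < K := by exact_mod_cast hK
  set D : ℝ := 1 / 20 * (√(2 * π))⁻¹ * exp (-(1 / 800)) / (2 * K) with hD
  have hD0 : 0 < D := by positivity
  have h1 : ∀ᶠ w : ℝ in atTop, w ^ 2 / 2 ≤ D * exp (1 / 20 * w) := by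
    have h := (tendsto_rpow_mul_exp_neg_mul_atTop_nhds_zero 2 (1 / 20) (by norm_num)).eventually_le_const
      (by positivity : 0 < 2 * D)
    filter_upwards [h] with w hw
    rw [neg_mul, exp_neg, ← div_eq_mul_inv, div_le_iff₀ (exp_pos _), rpow_two] at hw
    linarith
  have h2 : Tendsto (fun M : ℕ => √(2 * log ((K : ℝ) * M))) atTop atTop :=
    tendsto_sqrt_atTop.comp ((tendsto_log_mul_atTop hK).const_mul_atTop two_pos)
  filter_upwards [h2.eventually h1, h2.eventually (eventually_ge_atTop 1), eventually_ge_atTop 2,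
    (tendsto_log_mul_atTop hK).eventually (eventually_gt_atTop 0)] with M hM hM1 hM2 hL
  set w := √(2 * log ((K : ℝ) * M)) with hw
  have hw2 : w ^ 2 = 2 * log ((K : ℝ) * M) := sq_sqrt (by positivity)
  have hM2' : (2 : ℝ) ≤ M := by exact_mod_cast hM2
  have h3 : exp (w ^ 2 / 2) = K * M := by
    rw [hw2, mul_div_cancel_left₀ _ two_ne_zero, exp_log (by positivity)]
  have h4 := le_gaussian_Ici (y := w - 1 / 10) (h := 1 / 20) (by linarith) (by norm_num)
  have h5 : gaussianPDFReal 0 1 (w - 1 / 10 + 1 / 20) =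
      (√(2 * π))⁻¹ * exp (-(1 / 800)) * exp (1 / 20 * w) * exp (-(w ^ 2 / 2)) := by
    rw [gaussianPDFReal_std, mul_assoc, mul_assoc, ← exp_add, ← exp_add]
    congr 2; ring
  have h6 : (M : ℝ) / 2 ≤ (M - 1 : ℕ) := by
    rw [Nat.cast_sub (by omega)]; push_cast; linarith
  calc log ((K : ℝ) * M) = w ^ 2 / 2 := by rw [hw2]; ring
    _ ≤ D * exp (1 / 20 * w) := hM
    _ = M / 2 * (1 / 20 * gaussianPDFReal 0 1 (w - 1 / 10 + 1 / 20)) := by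
        rw [h5, hD, exp_neg (w ^ 2 / 2), h3]
        have : (M : ℝ) ≠ 0 := by positivity
        field_simp
    _ ≤ _ := mul_le_mul h6 h4 (mul_nonneg (by norm_num) (gaussianPDFReal_nonneg 0 1 _))
        (Nat.cast_nonneg _)

lemma integral_min_one_exp_mono {a u u' : ℝ} (ha : 0 ≤ a) (h : u' ≤ u) :
    ∫ x, min 1 (exp (a * (x - u))) ∂gaussianReal 0 1 ≤
      ∫ x, min 1 (exp (a * (x - u'))) ∂gaussianReal 0 1 := by
  refine integral_mono_of_nonneg
    (Eventually.of_forall fun x => le_min zero_le_one (exp_pos _).le)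
    (.of_bound (by fun_prop) 1 (Eventually.of_forall fun x => ?_))
    (Eventually.of_forall fun x => ?_)
  · rw [norm_eq_abs, abs_of_nonneg (le_min zero_le_one (exp_pos _).le)]
    exact min_le_left _ _
  · beta_reduce
    gcongr

lemma integral_min_one_exp_le_of_gap {a s u α ρ : ℝ} (ha : 60 ≤ a) (hs : 0 ≤ s)
    (hu : 35 / 100 * s - 1 / 10 ≤ u) (hρ0 : 0 < ρ) (hρ1 : ρ ≤ 18 / 100) (hρa : ρ * s ≤ a / 2)
    (hα1 : α ≤ ρ ^ 2 / 2) (hα2 : α ≤ 1 / 2) :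
    ∫ x, min 1 (exp (a * (x - u))) ∂gaussianReal 0 1 ≤ 9 / 10 * exp (-(α * s ^ 2)) := by
  have ha0 : 0 < a := by linarith
  rcases le_or_gt (6 / 10) s with hs6 | hs6
  · -- the threshold is exceeded by a multiple of `s`
    have hu' : ρ * s ≤ u := by
      have : ρ * s ≤ 18 / 100 * s := by gcongr
      linarith
    refine (integral_min_one_exp_mono ha0.le hu').trans ?_
    refine (integral_min_one_exp_le ha0 (by positivity) hρa).trans ?_
    rw [mul_comm]
    have h7 : 1 / a ≤ 1 / 60 := one_div_le_one_div_of_le (by norm_num) ha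
    have h8 : α * s ^ 2 ≤ (ρ * s) ^ 2 / 2 := by
      have := mul_le_mul_of_nonneg_right hα1 (sq_nonneg s)
      linarith
    gcongr
    linarith
  · -- the threshold may be missed by the margin `1 / 10`, but `exp (-α s²)` is close to `1`
    have h8 : ∫ x, min 1 (exp (a * (x - u))) ∂gaussianReal 0 1 ≤ 65 / 100 := by
      refine (integral_min_one_exp_mono ha0.le (u' := -(1 / 10)) (by linarith)).trans ?_
      simp only [sub_neg_eq_add]
      refine (integral_min_one_exp_add_le ha0 (by norm_num)).trans ?_
      have h9 : exp (-(a * (1 / 10))) ≤ 5 / 100 := by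
        rw [exp_neg, inv_le_comm₀ (exp_pos _) (by norm_num)]
        have := quadratic_le_exp_of_nonneg (x := a * (1 / 10)) (by linarith)
        nlinarith
      linarith
    have h10 := add_one_le_exp (-(α * s ^ 2))
    have : α * s ^ 2 ≤ 1 / 2 * (6 / 10) ^ 2 := by gcongr
    linarith

/-- The exponent in the lower bound for the state evolution parameters. -/
noncomputable def lowerRate (g lo : ℝ) : ℝ :=
  min (min (18 / 100) (√lo / 2) ^ 2 / 2) (min (1 / 2) (g ^ 2 * lo / 2))

lemma lowerRate_pos {g lo : ℝ} (hg : 0 < g) (hlo : 0 < lo) : 0 < lowerRate g lo := by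
  unfold lowerRate
  have : 0 < √lo := sqrt_pos.mpr hlo
  have h : 0 < min (18 / 100) (√lo / 2) := lt_min (by norm_num) (by positivity)
  exact lt_min (by positivity) (lt_min (by norm_num) (by positivity))

lemma gap_le_sqrt_sub {ν δ L : ℝ} (hδ : 0 < δ) (hν : 0 ≤ ν) (h : ν < 2 - δ) :
    35 / 100 * (δ * √L) ≤ √(2 * L) - √(ν * L) := by
  rw [sqrt_mul zero_le_two, sqrt_mul hν, ← sub_mul, ← mul_assoc]
  refine mul_le_mul_of_nonneg_right ?_ (sqrt_nonneg L)
  have h2 : √2 ^ 2 = 2 := sq_sqrt zero_le_two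
  have hν2 : √ν ^ 2 = ν := sq_sqrt hν
  have hle : √ν ≤ √2 := sqrt_le_sqrt (by linarith)
  have hlt : √2 ≤ 1.4143 := sqrt_le_iff.mpr ⟨by norm_num, by norm_num⟩
  have h3 : δ ≤ (√2 - √ν) * (√2 + √ν) := by nlinarith
  nlinarith [sqrt_nonneg ν]

lemma eventually_scriptE_le {K : ℕ} (hK : 1 ≤ K) {g lo : ℝ} (hg0 : 0 < g) (hg1 : g ≤ 1)
    (hg : PhaseGap K g) (hlo : 0 < lo) :
    ∀ᶠ M : ℕ in atTop, ∀ δ ∈ Set.Ioo (0 : ℝ) 1, ∀ ν, lo ≤ ν → ν < 2 - δ →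
      scriptE K M (1 / (ν * log (K * M))) ≤ (M : ℝ) ^ (-(lowerRate g lo * δ ^ 2)) := by
  set α := lowerRate g lo with hα
  set ρ := min (18 / 100) (√lo / 2) with hρ
  have hα0 : 0 < α := lowerRate_pos hg0 hlo
  have hα1 : α ≤ ρ ^ 2 / 2 := min_le_left _ _
  have hα2 : α ≤ 1 / 2 := (min_le_right _ _).trans (min_le_left _ _)
  have hα3 : α ≤ g ^ 2 * lo / 2 := (min_le_right _ _).trans (min_le_right _ _)
  have hslo : 0 < √lo := sqrt_pos.mpr hlo
  have hρ0 : 0 < ρ := lt_min (by norm_num) (by positivity)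
  have e1 : ∀ᶠ L : ℝ in atTop, K * exp (-(g ^ 2 * lo / 2 * L)) ≤ 5 / 100 := by
    filter_upwards [(tendsto_mul_exp_neg_mul (by positivity : 0 < g ^ 2 * lo / 2)
      (K : ℝ)).eventually_le_const (by norm_num : (0 : ℝ) < 5 / 100), eventually_ge_atTop 1]
      with L hL hL1
    refine le_trans ?_ hL
    gcongr
    exact le_mul_of_one_le_left (exp_pos _).le hL1
  have e2 : ∀ᶠ L : ℝ in atTop, exp (-(L / 2)) ≤ 5 / 100 := by
    filter_upwards [(tendsto_mul_exp_neg_mul (by norm_num : (0 : ℝ) < 1 / 2) 1).eventually_le_const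
      (by norm_num : (0 : ℝ) < 5 / 100), eventually_ge_atTop 1] with L hL hL1
    refine le_trans ?_ hL
    rw [one_mul, div_eq_inv_mul, ← one_div]
    exact le_mul_of_one_le_left (exp_pos _).le hL1
  have e3 := (tendsto_sqrt_atTop.comp (tendsto_id.const_mul_atTop hlo)).eventually
    (eventually_ge_atTop (max 60 (1 / g)))
  have hlog := tendsto_log_mul_atTop hK
  filter_upwards [hlog.eventually e1, hlog.eventually e2, hlog.eventually e3,
    eventually_log_le_mul_gaussian_Ici hK, hlog.eventually (eventually_gt_atTop 0),
    eventually_ge_atTop 1] with M h1 h2 h3 h4 hL hM δ hδ ν hlν hν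
  set L := log ((K : ℝ) * M) with hLdef
  obtain ⟨hδ0, hδ1⟩ := hδ
  have hν0 : 0 < ν := hlo.trans_le hlν
  have hc : 0 < ν * L := by positivity
  simp only [Function.comp, id] at h3
  have hsqrt : √(lo * L) ≤ √(ν * L) := sqrt_le_sqrt (by gcongr)
  have ha60 : 60 ≤ √(ν * L) := (le_max_left _ _).trans (h3.trans hsqrt)
  have hag : 1 ≤ g * √(ν * L) := by
    have := (le_max_right _ _).trans (h3.trans hsqrt)
    rwa [div_le_iff₀ hg0, mul_comm] at this
  set s := δ * √L with hs
  have hs0 : 0 < s := by positivity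
  have hs2 : s ^ 2 = δ ^ 2 * L := by rw [hs, mul_pow, sq_sqrt hL.le]
  have hsL : s ^ 2 ≤ L := by rw [hs2]; exact mul_le_of_le_one_left hL.le (by nlinarith)
  have hgap := gap_le_sqrt_sub (L := L) hδ0 hν0.le hν
  have hgoal : exp (-(α * s ^ 2)) ≤ (M : ℝ) ^ (-(α * δ ^ 2)) := by
    rw [rpow_def_of_pos (by positivity), hs2]
    refine exp_le_exp.mpr ?_
    have : log (M : ℝ) ≤ L := log_le_log (by positivity)
      (le_mul_of_one_le_left (by positivity) (by exact_mod_cast hK))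
    have := mul_le_mul_of_nonneg_left this (by positivity : 0 ≤ α * δ ^ 2)
    linarith
  refine le_trans ?_ hgoal
  refine (scriptE_le_integral hK M hc hg0.le hg1 hg (y := √(2 * L) - 1 / 10) ?_).trans ?_
  · have : √(ν * L) ≤ √(2 * L) := sqrt_le_sqrt (by nlinarith)
    linarith
  have hT1 : exp (-((M - 1 : ℕ) * (gaussianReal 0 1).real (Set.Ici (√(2 * L) - 1 / 10)))) ≤
      5 / 100 * exp (-(α * s ^ 2)) := by
    calc _ ≤ exp (-L) := exp_le_exp.mpr (by linarith)
      _ = exp (-(L / 2)) * exp (-(L / 2)) := by rw [← exp_add]; congr 1; ring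
      _ ≤ 5 / 100 * exp (-(α * s ^ 2)) := by
        gcongr
        nlinarith [sq_nonneg s]
  have hT2 : K * exp (-(g ^ 2 * (ν * L))) ≤ 5 / 100 * exp (-(α * s ^ 2)) := by
    calc _ ≤ K * exp (-(g ^ 2 * (lo * L))) := by gcongr
      _ = K * exp (-(g ^ 2 * lo / 2 * L)) * exp (-(g ^ 2 * lo / 2 * L)) := by
        rw [mul_assoc, ← exp_add]; congr 2; ring
      _ ≤ 5 / 100 * exp (-(α * s ^ 2)) := by
        gcongr
  have hT3 : ∫ x, min 1 (exp (√(ν * L) * (x - (√(2 * L) - 1 / 10 - √(ν * L))))) ∂gaussianReal 0 1 ≤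
      9 / 10 * exp (-(α * s ^ 2)) := by
    refine integral_min_one_exp_le_of_gap ha60 hs0.le (by linarith) hρ0 (min_le_left _ _) ?_
      hα1 hα2
    have h5 : s ≤ √L := by rw [hs]; exact mul_le_of_le_one_left (sqrt_nonneg _) hδ1.le
    have h6 : √lo * √L ≤ √(ν * L) := by rwa [← sqrt_mul hlo.le]
    calc ρ * s ≤ √lo / 2 * √L := by gcongr; exact min_le_right _ _
      _ ≤ _ := by linarith
  linarith

/-! ### State evolution -/

namespace System

variable (S : System)

/-- The column average `(1/R) ∑_r W_rc / φ_r`, as a function of the vector `ψ`. -/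
noncomputable def avgOf (ψ : Fin S.cols → ℝ) (c : Fin S.cols) : ℝ :=
  1 / (S.rows : ℝ) * ∑ r, S.W r c / S.phiOf ψ r

variable {S}

lemma phiOf_mem {ψ : Fin S.cols → ℝ} (hψ : ∀ c, ψ c ∈ Set.Icc 0 2) (r : Fin S.rows) :
    S.phiOf ψ r ∈ Set.Icc (S.σ ^ 2) (S.σ ^ 2 + 2 * S.ξ₂) := by
  have h0 : 0 ≤ ∑ c, S.W r c * ψ c :=
    Finset.sum_nonneg fun c _ => mul_nonneg (S.W_nonneg r c) (hψ c).1
  have h1 : ∑ c, S.W r c * ψ c ≤ 2 * ∑ c, S.W r c := by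
    rw [Finset.mul_sum]
    exact Finset.sum_le_sum fun c _ => by nlinarith [S.W_nonneg r c, (hψ c).2]
  have h2 : 1 / (S.cols : ℝ) * ∑ c, S.W r c * ψ c ≤ 1 / (S.cols : ℝ) * (2 * ∑ c, S.W r c) := by
    gcongr
  have h3 : 0 ≤ 1 / (S.cols : ℝ) * ∑ c, S.W r c * ψ c := by positivity
  have h4 := (S.row_avg r).2
  constructor
  · unfold phiOf; linarith
  · unfold phiOf; linarith

lemma avgOf_mem {ψ : Fin S.cols → ℝ} (hψ : ∀ c, ψ c ∈ Set.Icc 0 2) (c : Fin S.cols) :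
    S.avgOf ψ c ∈ Set.Icc (S.ξ₁ / (S.σ ^ 2 + 2 * S.ξ₂)) (S.ξ₂ / S.σ ^ 2) := by
  have hσ : 0 < S.σ ^ 2 := pow_pos S.σ_pos 2
  have hξ := S.ξ₂_pos
  constructor
  · calc S.ξ₁ / (S.σ ^ 2 + 2 * S.ξ₂)
        ≤ (1 / (S.rows : ℝ) * ∑ r, S.W r c) / (S.σ ^ 2 + 2 * S.ξ₂) := by
          gcongr; exact (S.col_avg c).1
      _ = 1 / (S.rows : ℝ) * ∑ r, S.W r c / (S.σ ^ 2 + 2 * S.ξ₂) := by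
          rw [← Finset.sum_div, mul_div_assoc]
      _ ≤ _ := by
          unfold avgOf
          gcongr with r
          · exact S.W_nonneg r c
          · exact hσ.trans_le (phiOf_mem hψ r).1
          · exact (phiOf_mem hψ r).2
  · calc S.avgOf ψ c ≤ 1 / (S.rows : ℝ) * ∑ r, S.W r c / S.σ ^ 2 := by
          unfold avgOf
          gcongr with r
          · exact S.W_nonneg r c
          · exact (phiOf_mem hψ r).1
      _ = (1 / (S.rows : ℝ) * ∑ r, S.W r c) / S.σ ^ 2 := by rw [← Finset.sum_div, mul_div_assoc]
      _ ≤ _ := by gcongr; exact (S.col_avg c).2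

lemma tauOf_eq (K M : ℕ) (ψ : Fin S.cols → ℝ) (c : Fin S.cols) :
    S.tauOf K M ψ c = 1 / (2 / S.R * S.avgOf ψ c * log (K * M)) := by
  rw [tauOf, ← avgOf]
  simp only [div_eq_mul_inv, mul_inv, inv_inv, one_mul]
  ring

lemma nu_eq {K M : ℕ} (hKM : 1 < K * M) (t : ℕ) (c : Fin S.cols) :
    S.nu K M t c = 2 / S.R * S.avgOf (S.psi K M t) c := by
  have hL : log ((K : ℝ) * M) ≠ 0 := (log_pos (by exact_mod_cast hKM)).ne'
  rw [nu, tau, tauOf_eq, one_div_mul_eq_div, one_div_div, mul_div_cancel_right₀ _ hL]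

lemma psi_succ {K M : ℕ} (hKM : 1 < K * M) (t : ℕ) (c : Fin S.cols) :
    S.psi K M (t + 1) c = 1 - scriptE K M (1 / (S.nu K M t c * log (K * M))) := by
  rw [nu_eq hKM, ← tauOf_eq]; rfl

lemma nuLower_pos : 0 < S.nuLower := by
  have := S.R_pos; have := S.ξ₁_pos; have := S.ξ₂_pos
  unfold nuLower; positivity

lemma two_div_mul_avgOf_mem {ψ : Fin S.cols → ℝ} (hψ : ∀ c, ψ c ∈ Set.Icc 0 2) (c : Fin S.cols) :
    2 / S.R * S.avgOf ψ c ∈ Set.Icc S.nuLower S.nuUpper := by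
  have h := avgOf_mem hψ c
  have hR := S.R_pos
  unfold nuLower nuUpper
  exact ⟨by gcongr; exact h.1, by gcongr; exact h.2⟩

lemma psi_mem {K M : ℕ} (hKM : 1 < K * M) (t : ℕ) (c : Fin S.cols) :
    S.psi K M t c ∈ Set.Icc 0 2 := by
  have hK : 1 ≤ K := Nat.one_le_iff_ne_zero.mpr (by rintro rfl; simp at hKM)
  have hL : 0 < log ((K : ℝ) * M) := log_pos (by exact_mod_cast hKM)
  induction t generalizing c with
  | zero => exact ⟨zero_le_one, one_le_two⟩
  | succ t ih =>
    have hν : 0 < S.nu K M t c := by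
      rw [nu_eq hKM]
      exact nuLower_pos.trans_le (two_div_mul_avgOf_mem ih c).1
    rw [psi_succ hKM]
    have h1 := scriptE_le_one hK M (mul_pos hν hL)
    have h2 := neg_one_le_scriptE hK M (mul_pos hν hL)
    exact ⟨by linarith, by linarith⟩

lemma nu_mem {K M : ℕ} (hKM : 1 < K * M) (t : ℕ) (c : Fin S.cols) :
    S.nu K M t c ∈ Set.Icc S.nuLower S.nuUpper := by
  rw [nu_eq hKM]
  exact two_div_mul_avgOf_mem (psi_mem hKM t) c

lemma nu_eq_sum {K M : ℕ} (hKM : 1 < K * M) (t : ℕ) (c : Fin S.cols) :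
    S.nu K M t c = 2 / (S.R * S.rows) * ∑ r, S.W r c / S.phi K M t r := by
  rw [nu_eq hKM, avgOf, ← mul_assoc, div_mul_div_comm, mul_one]
  rfl

end System

/-- Bounds for `1 - scriptE` at all signal-to-noise ratios are bounds for state evolution. -/
lemma upperBoundsPsi_of_scriptE {K : ℕ} (hK : 1 ≤ K) {lo hi : ℝ} {M₀ : ℕ} {f h : ℕ → ℝ → ℝ}
    (hM₀ : 2 ≤ M₀)
    (hf0 : ∀ M, M₀ ≤ M → ∀ δ ∈ Set.Ioo (0 : ℝ) (1 / 2), 0 ≤ f M δ)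
    (hh0 : ∀ M, M₀ ≤ M → ∀ ν ∈ Set.Icc lo hi, 0 ≤ h M ν)
    (hft : ∀ δ ∈ Set.Ioo (0 : ℝ) (1 / 2), Tendsto (fun M => f M δ) atTop (𝓝 0))
    (hht : ∀ ν : ℕ → ℝ, (∀ M, ν M ∈ Set.Icc lo hi) → Tendsto (fun M => h M (ν M)) atTop (𝓝 0))
    (hf : ∀ M, M₀ ≤ M → ∀ δ ∈ Set.Ioo (0 : ℝ) (1 / 2), ∀ ν, 2 + δ < ν →
      1 - scriptE K M (1 / (ν * log (K * M))) ≤ f M δ)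
    (hh : ∀ M, M₀ ≤ M → ∀ ν ∈ Set.Icc lo hi,
      1 - scriptE K M (1 / (ν * log (K * M))) ≤ 1 + h M ν) :
    UpperBoundsPsi K lo hi M₀ f h := by
  refine ⟨hf0, hh0, hft, hht, fun M hM S hlo hhi t c δ hδ => ?_⟩
  have hKM : 1 < K * M := by nlinarith
  have hν := S.nu_mem hKM t c
  rw [hlo, hhi] at hν
  rw [System.psi_succ hKM]
  rcases lt_or_ge (2 + δ) (S.nu K M t c) with hlt | hge
  · rw [if_pos hlt, if_neg hlt.not_ge, add_zero]
    exact hf M hM δ hδ _ hlt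
  · rw [if_neg hge.not_gt, if_pos hge, zero_add]
    exact hh M hM _ hν

/-! ### The explicit functions for `K` a power of `2` -/

lemma fBound_nonneg (a : ℝ) (K M : ℕ) {δ : ℝ} (hδ : 0 < δ) : 0 ≤ fBound a K M δ := by
  unfold fBound; positivity

lemma hBound_nonneg (a : ℝ) (K M : ℕ) (ν : ℝ) : 0 ≤ hBound a K M ν := by
  unfold hBound; positivity

lemma fBound_anti {a b : ℝ} (hab : a ≤ b) {K M : ℕ} (hK : 1 ≤ K) (hM : 1 ≤ M) {δ : ℝ} (hδ : 0 < δ) :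
    fBound b K M δ ≤ fBound a K M δ := by
  have : (1 : ℝ) ≤ K * M := by exact_mod_cast Nat.mul_pos hK hM
  unfold fBound
  gcongr

lemma cotFactor_bounds {K : ℕ} (hK : 8 ≤ K) :
    1 ≤ cotFactor K ∧ 1 / 10 ≤ cotFactor K ^ 2 * sin (π / K) ^ 2 ∧
      cotFactor K ^ 2 * sin (π / K) ^ 2 ≤ 4 := by
  have hK' : (8 : ℝ) ≤ K := by exact_mod_cast hK
  have hpi := pi_pos
  set θ := π / K with hθ
  have hθ0 : 0 < θ := by positivity
  have hθ1 : θ ≤ π / 8 := by rw [hθ]; gcongr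
  have hs : 0 < sin θ := sin_pos_of_pos_of_lt_pi hθ0 (by linarith)
  have hc : 0 < cos θ := cos_pos_of_mem_Ioo ⟨by linarith, by linarith⟩
  have hq : cotFactor K = 1 + cos (2 * θ) / (2 * sin θ * cos θ) := by
    rw [cotFactor, cot_eq_cos_div_sin, mul_div_assoc, ← hθ, sin_two_mul]
  have hcos : √2 / 2 ≤ cos (2 * θ) := by
    rw [← cos_pi_div_four]
    exact cos_le_cos_of_nonneg_of_le_pi (by linarith) (by linarith) (by linarith)
  have h7 : (7 / 10 : ℝ) ≤ cos (2 * θ) := by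
    have : (14 / 10 : ℝ) ≤ √2 := le_sqrt_of_sq_le (by norm_num)
    linarith
  have hqs : cotFactor K * sin θ = sin θ + cos (2 * θ) / (2 * cos θ) := by
    rw [hq]; field_simp
  have hlow : 35 / 100 ≤ cotFactor K * sin θ := by
    rw [hqs]
    have : 35 / 100 ≤ cos (2 * θ) / (2 * cos θ) := by
      rw [le_div_iff₀ (by positivity)]
      linarith [cos_le_one θ]
    linarith
  have hup : cotFactor K * sin θ ≤ 2 := by
    rw [hqs]
    have : cos (2 * θ) / (2 * cos θ) ≤ 1 := by
      rw [div_le_one (by positivity), cos_two_mul]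
      nlinarith [cos_le_one θ]
    linarith [sin_le_one θ]
  refine ⟨?_, ?_, ?_⟩
  · rw [hq]
    have : 0 ≤ cos (2 * θ) / (2 * sin θ * cos θ) := by
      have : 0 ≤ cos (2 * θ) := by linarith
      positivity
    linarith
  · rw [← mul_pow]; nlinarith
  · rw [← mul_pow]; nlinarith

/-- A phase gap of the `K`-PSK constellation, with its relation to `cotFactor` for `K ≥ 8`. -/
lemma exists_phaseGap {K : ℕ} (hK : 1 ≤ K) : ∃ g : ℝ, 0 < g ∧ g ≤ 1 ∧ PhaseGap K g ∧
    (K = 1 ∨ K = 2 ∨ K = 4 → 1 / 2 ≤ g) ∧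
    (8 ≤ K → g = sin (π / K) ^ 2) := by
  rcases Nat.lt_or_ge K 2 with h | h
  · obtain rfl : K = 1 := by omega
    exact ⟨1, one_pos, le_rfl, phaseGap_one, fun _ => by norm_num, fun h => by omega⟩
  · have hK' : (2 : ℝ) ≤ K := by exact_mod_cast h
    have hlt : π / K < π := by
      rw [div_lt_iff₀ (by linarith)]; nlinarith [pi_pos]
    have hs : 0 < sin (π / K) := sin_pos_of_pos_of_lt_pi (by positivity) hlt
    refine ⟨sin (π / K) ^ 2, by positivity, sin_sq_le_one _, phaseGap_sin h, ?_, fun _ => rfl⟩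
    rintro (rfl | rfl | rfl)
    · omega
    · norm_num
    · norm_num [div_pow]

/-- The common value of the universal constants. -/
noncomputable def kappa : ℝ := 1 / 10000

lemma fExact_eq_fBound {K : ℕ} (hK : K = 1 ∨ K = 2 ∨ K = 4) (κ : ℝ) (M : ℕ) (δ : ℝ) :
    fExact κ κ κ κ K M δ = fBound κ K M δ := by
  rcases hK with rfl | rfl | rfl <;> simp [fExact, fBound]

lemma fExact_of_eight_le {K : ℕ} (hK : 8 ≤ K) (κ : ℝ) (M : ℕ) (δ : ℝ) :
    fExact κ κ κ κ K M δ = cotFactor K * fBound (κ / cotFactor K ^ 2) K M δ +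
      K * ((K : ℝ) * M) ^ (-(2 * (2 + δ ^ 2) * sin (π / K) ^ 2)) := by
  rw [fExact, if_neg (by omega), if_neg (by omega), if_neg (by omega), fBound, mul_div_assoc]
  congr 5
  ring

lemma fBound_le_fExact {K M : ℕ} (hK : K = 1 ∨ K = 2 ∨ K = 4 ∨ 8 ≤ K) (hM : 1 ≤ M) {g δ : ℝ}
    (hg1 : K = 1 ∨ K = 2 ∨ K = 4 → 1 / 2 ≤ g) (hg2 : 8 ≤ K → g = sin (π / K) ^ 2) (hδ : 0 < δ) :
    fBound (g / 1000) K M δ ≤ fExact kappa kappa kappa kappa K M δ := by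
  by_cases h8 : 8 ≤ K
  · obtain ⟨hq1, hq2, -⟩ := cotFactor_bounds h8
    rw [← hg2 h8] at hq2
    rw [fExact_of_eight_le h8]
    have hq0 : 0 < cotFactor K ^ 2 := by positivity
    have h1 : kappa / cotFactor K ^ 2 ≤ g / 1000 := by
      rw [div_le_iff₀ hq0, kappa]; linarith
    have h2 := fBound_anti h1 (by omega : 1 ≤ K) hM hδ
    have h3 : 0 ≤ K * ((K : ℝ) * M) ^ (-(2 * (2 + δ ^ 2) * sin (π / K) ^ 2)) := by positivity
    have h4 := fBound_nonneg (kappa / cotFactor K ^ 2) K M hδ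
    nlinarith
  · have h : K = 1 ∨ K = 2 ∨ K = 4 := by omega
    rw [fExact_eq_fBound h]
    refine fBound_anti ?_ (by omega) hM hδ
    rw [kappa]
    linarith [hg1 h]

lemma eventually_fExact_le {K : ℕ} (hK : K = 1 ∨ K = 2 ∨ K = 4 ∨ 8 ≤ K) {g δ : ℝ} (hg0 : 0 < g)
    (hg1 : g ≤ 1) (hg2 : 8 ≤ K → g = sin (π / K) ^ 2) (hδ : 0 < δ) (hδ1 : δ < 1 / 2) :
    ∀ᶠ M : ℕ in atTop, fExact kappa kappa kappa kappa K M δ ≤ fBound (kappa * g / 8) K M δ := by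
  have hK1 : 1 ≤ K := by omega
  by_cases h8 : 8 ≤ K
  · obtain ⟨hq1, -, hq3⟩ := cotFactor_bounds h8
    rw [← hg2 h8] at hq3
    set q := cotFactor K with hq
    have hq0 : 0 < q ^ 2 := by positivity
    have hκ : 0 < kappa := by norm_num [kappa]
    have hα : kappa * g / 8 ≤ kappa / q ^ 2 / 2 := by
      rw [div_div, le_div_iff₀ (by positivity)]
      nlinarith
    set b := kappa / q ^ 2 / 2 * δ ^ 2 with hb
    have hb0 : 0 < b := by positivity
    have e1 := (tendsto_mul_exp_neg_mul hb0 q).eventually_le_const (half_pos one_pos)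
    have e2 := (tendsto_mul_exp_neg_mul hg0 (K : ℝ)).eventually_le_const (half_pos one_pos)
    have hlog := tendsto_log_mul_atTop hK1
    filter_upwards [hlog.eventually e1, hlog.eventually e2, hlog.eventually (eventually_ge_atTop 1),
      eventually_ge_atTop 1] with M h1 h2 hL hM
    rw [fExact_of_eight_le h8, fBound, fBound, ← hg2 h8, ← hq]
    simp only [rpow_eq_exp_log hK1 hM]
    set L := log ((K : ℝ) * M)
    have hL0 : 0 < L := by linarith
    have hs1 : √L ≤ L := sqrt_le_iff.mpr ⟨by linarith, by nlinarith⟩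
    have hs0 : 0 < √L := sqrt_pos.mpr hL0
    set s := δ * √L with hs
    have hsp : 0 < s := by positivity
    have hsL : s ≤ L := by nlinarith
    have h3 : q * exp (L * -(kappa / q ^ 2 * δ ^ 2)) ≤ 1 / 2 * exp (L * -(kappa * g / 8 * δ ^ 2)) := by
      calc q * exp (L * -(kappa / q ^ 2 * δ ^ 2))
          = q * (1 * exp (-(b * L))) * exp (L * -(kappa / q ^ 2 / 2 * δ ^ 2)) := by
            rw [one_mul, mul_assoc, ← exp_add]; congr 2; rw [hb]; ring
        _ ≤ q * (L * exp (-(b * L))) * exp (L * -(kappa * g / 8 * δ ^ 2)) := by gcongr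
        _ ≤ _ := by gcongr
    have h4 : K * exp (L * -(2 * (2 + δ ^ 2) * g)) * s ≤
        1 / 2 * exp (L * -(kappa * g / 8 * δ ^ 2)) := by
      calc _ ≤ K * (exp (-(g * L)) * exp (L * -(kappa * g / 8 * δ ^ 2))) * L := by
            rw [← exp_add]
            gcongr
            have hLg : 0 < L * g := by positivity
            have h5 : kappa / 8 * δ ^ 2 ≤ 1 := by rw [kappa]; nlinarith
            have h6 := mul_le_mul_of_nonneg_left h5 hLg.le
            have h7 : 0 ≤ L * g * δ ^ 2 := by positivity
            linarith
        _ = K * (L * exp (-(g * L))) * exp (L * -(kappa * g / 8 * δ ^ 2)) := by ring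
        _ ≤ _ := by gcongr
    rw [le_div_iff₀ hsp, add_mul, mul_assoc q, div_mul_cancel₀ _ hsp.ne']
    linarith
  · have h : K = 1 ∨ K = 2 ∨ K = 4 := by omega
    filter_upwards [eventually_ge_atTop 1] with M hM
    rw [fExact_eq_fBound h]
    refine fBound_anti ?_ hK1 hM hδ
    rw [kappa]
    linarith

lemma hExact_of_eight_le {K M : ℕ} (hK : 8 ≤ K) (hM : 1 ≤ M) (ν : ℝ) :
    hExact K M ν = 2 * cotFactor K * (exp (-(ν * log (K * M) / (2 * cotFactor K ^ 2))) /
      √(2 * π * (ν * log (K * M)))) := by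
  rw [hExact, if_neg (by omega), if_neg (by omega), if_neg (by omega),
    rpow_eq_exp_log (by omega : 1 ≤ K) hM, mul_div_assoc, mul_assoc (2 * π)]
  congr 3
  ring

lemma hExact_two {M : ℕ} (hM : 1 ≤ M) (ν : ℝ) :
    hExact 2 M ν = exp (-(ν * log ((2 : ℕ) * M) / 2)) / √(2 * π * (ν * log ((2 : ℕ) * M))) := by
  have := rpow_eq_exp_log (K := 2) (by omega) hM (-(ν / 2))
  rw [hExact, if_neg (by omega), if_pos rfl, mul_assoc (2 * π)]
  push_cast at this ⊢
  rw [this]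
  congr 2
  ring

lemma hExact_four {M : ℕ} (hM : 1 ≤ M) (ν : ℝ) :
    hExact 4 M ν =
      2 * (exp (-(ν * log ((4 : ℕ) * M) / 2)) / √(2 * π * (ν * log ((4 : ℕ) * M)))) := by
  have := rpow_eq_exp_log (K := 4) (by omega) hM (-(ν / 2))
  rw [hExact, if_neg (by omega), if_neg (by omega), if_pos rfl, mul_assoc (2 * π)]
  push_cast at this ⊢
  rw [this, mul_div_assoc]
  congr 3
  ring

lemma hExact_nonneg {K : ℕ} (hK : K = 1 ∨ K = 2 ∨ K = 4 ∨ 8 ≤ K) {M : ℕ} (hM : 1 ≤ M) (ν : ℝ) :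
    0 ≤ hExact K M ν := by
  rcases hK with rfl | rfl | rfl | h
  · simp [hExact]
  · rw [hExact_two hM]; positivity
  · rw [hExact_four hM]; positivity
  · have := (cotFactor_bounds h).1
    rw [hExact_of_eight_le h hM]
    positivity

lemma mills_le_hExact {K : ℕ} (hK : K = 2 ∨ K = 4 ∨ 8 ≤ K) {M : ℕ} (hM : 1 ≤ M) {ν : ℝ}
    (hν : 0 ≤ ν * log (K * M)) :
    exp (-(ν * log (K * M) / 2)) / √(2 * π * (ν * log (K * M))) ≤ hExact K M ν := by
  rcases hK with rfl | rfl | h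
  · rw [hExact_two hM]
  · rw [hExact_four hM]
    exact le_mul_of_one_le_left (by positivity) one_le_two
  · have hq := (cotFactor_bounds h).1
    rw [hExact_of_eight_le h hM]
    have h1 : exp (-(ν * log (K * M) / 2)) ≤ exp (-(ν * log (K * M) / (2 * cotFactor K ^ 2))) := by
      refine exp_le_exp.mpr (neg_le_neg ?_)
      exact div_le_div_of_nonneg_left hν two_pos (by nlinarith)
    calc _ ≤ 1 * (exp (-(ν * log (K * M) / (2 * cotFactor K ^ 2))) /
          √(2 * π * (ν * log (K * M)))) := by rw [one_mul]; gcongr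
      _ ≤ _ := by gcongr; linarith

lemma eventually_hExact_le {K : ℕ} (hK : K = 1 ∨ K = 2 ∨ K = 4 ∨ 8 ≤ K) {g lo : ℝ} (hg0 : 0 < g)
    (hg1 : g ≤ 1) (hg2 : 8 ≤ K → g = sin (π / K) ^ 2) (hlo : 0 < lo) :
    ∀ᶠ M : ℕ in atTop, ∀ ν, lo ≤ ν → hExact K M ν ≤ hBound (g / 16) K M ν := by
  have hK1 : 1 ≤ K := by omega
  have e1 := (tendsto_log_mul_atTop hK1).eventually
    (eventually_forall_mul (eventually_ge_atTop (1 : ℝ)) hlo)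
  filter_upwards [e1, eventually_mul_exp_le_hBound hK1 (C := 2 * max 1 (cotFactor K))
    (a := g / 16) (b := g / 8) (by positivity) (by linarith) hlo, eventually_ge_atTop 1]
    with M h1 h2 hM ν hν
  refine le_trans ?_ (h2 ν hν)
  have hc := h1 ν hν
  set c := ν * log ((K : ℝ) * M) with hcdef
  have hroot : ∀ x, exp (-x) / √(2 * π * c) ≤ exp (-x) := fun x => by
    refine div_le_self (exp_pos _).le ?_
    rw [one_le_sqrt]
    nlinarith [pi_gt_three]
  have hmax1 : (1 : ℝ) ≤ max 1 (cotFactor K) := le_max_left _ _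
  have hhalf : exp (-(c / 2)) ≤ exp (-(g / 8 * c)) := exp_le_exp.mpr (by nlinarith)
  have he := exp_pos (-(g / 8 * c))
  rcases hK with rfl | rfl | rfl | h
  · simp only [hExact, if_true]; positivity
  · rw [hExact_two hM, ← hcdef]
    nlinarith [hroot (c / 2)]
  · rw [hExact_four hM, ← hcdef]
    nlinarith [hroot (c / 2)]
  · obtain ⟨hq1, -, hq3⟩ := cotFactor_bounds h
    rw [← hg2 h] at hq3
    rw [hExact_of_eight_le h hM, ← hcdef]
    have h3 : exp (-(c / (2 * cotFactor K ^ 2))) ≤ exp (-(g / 8 * c)) := by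
      refine exp_le_exp.mpr (neg_le_neg ?_)
      rw [le_div_iff₀ (by positivity)]
      nlinarith
    have h4 : cotFactor K ≤ max 1 (cotFactor K) := le_max_right _ _
    calc _ ≤ 2 * cotFactor K * exp (-(g / 8 * c)) := by
          gcongr; exact (hroot _).trans h3
      _ ≤ _ := by gcongr

lemma one_sub_scriptE_le_hExact {m K M : ℕ} (hm : K = 2 ^ m) (hM : 2 ≤ M) {ν : ℝ} (hν : 0 < ν) :
    1 - scriptE K M (1 / (ν * log (K * M))) ≤ 1 + hExact K M ν := by
  have hK1 : 1 ≤ K := hm ▸ Nat.one_le_two_pow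
  have hL : 0 < log ((K : ℝ) * M) := by
    refine log_pos ?_
    have : 1 < K * M := by nlinarith
    exact_mod_cast this
  have hc := mul_pos hν hL
  rcases m with - | m
  · obtain rfl : K = 1 := hm
    have := one_sub_scriptE_le_one_add le_rfl (by omega : 1 ≤ M) hc phaseGap_one
    simpa [hExact] using this
  · have h2 : K = 2 * 2 ^ m := by rw [hm, pow_succ, mul_comm]
    have h3 := one_sub_scriptE_le_of_even (m := 2 ^ m) (M := M) Nat.one_le_two_pow hc
    rw [← h2] at h3
    refine h3.trans (add_le_add_right (mills_le_hExact ?_ (by omega) hc.le) _)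
    rcases m with - | - | m
    · left; simpa using hm
    · right; left; simpa using hm
    · right; right
      have : 1 ≤ 2 ^ m := Nat.one_le_two_pow
      rw [hm, pow_add]
      omega

lemma two_pow_cases {K m : ℕ} (hm : K = 2 ^ m) : K = 1 ∨ K = 2 ∨ K = 4 ∨ 8 ≤ K := by
  subst hm
  rcases m with - | - | - | m
  · simp
  · simp
  · simp
  · have : 1 ≤ 2 ^ m := Nat.one_le_two_pow
    rw [show m + 1 + 1 + 1 = m + 3 from rfl, pow_add]
    omega

end ModSparc

open ModSparc in
theorem proposition1 :
    -- the signal-to-noise ratios and their bounds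
    (∀ K M : ℕ, 1 < K * M → ∀ (S : System) (t : ℕ) (c : Fin S.cols),
      S.nu K M t c = 2 / (S.R * S.rows) * ∑ r, S.W r c / S.phi K M t r ∧
      2 / S.R * (S.ξ₁ / (S.σ ^ 2 + 2 * S.ξ₂)) ≤ S.nu K M t c ∧
      S.nu K M t c ≤ 2 / S.R * (S.ξ₂ / S.σ ^ 2)) ∧
    -- the bounds on the state evolution parameters; `κ₁, …, κ₄` are universal constants
    ∃ κ₁ κ₂ κ₃ κ₄ : ℝ, 0 < κ₁ ∧ 0 < κ₂ ∧ 0 < κ₃ ∧ 0 < κ₄ ∧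
      ∀ K : ℕ, 1 ≤ K → ∀ lo hi : ℝ, 0 < lo → lo ≤ hi →
        ∃ α α₁ α₂ : ℝ, 0 < α ∧ 0 < α₁ ∧ 0 < α₂ ∧ ∃ M₀ : ℕ,
          -- (a), with `f` and `h` bounded as claimed, for every `K`
          (∃ f h : ℕ → ℝ → ℝ, UpperBoundsPsi K lo hi M₀ f h ∧
            (∀ M, M₀ ≤ M → ∀ δ ∈ Set.Ioo (0 : ℝ) (1 / 2), f M δ ≤ fBound α₁ K M δ) ∧
            (∀ M, M₀ ≤ M → ∀ ν ∈ Set.Icc lo hi, h M ν ≤ hBound α₂ K M ν)) ∧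
          -- (b)
          (∀ M, M₀ ≤ M → ∀ S : System, S.nuLower = lo → S.nuUpper = hi →
            ∀ (t : ℕ) (c : Fin S.cols), ∀ δ' ∈ Set.Ioo (0 : ℝ) 1,
              (if S.nu K M t c < 2 - δ' then 1 - (M : ℝ) ^ (-(α * δ' ^ 2)) else 0) ≤
                S.psi K M (t + 1) c) ∧
          -- (a), with the explicit `f` and `h`, when `K` is a power of `2`
          ((∃ m : ℕ, K = 2 ^ m) →
            UpperBoundsPsi K lo hi M₀ (fExact κ₁ κ₂ κ₃ κ₄ K) (hExact K) ∧
            (∀ δ ∈ Set.Ioo (0 : ℝ) (1 / 2), ∀ᶠ M : ℕ in Filter.atTop,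
              fExact κ₁ κ₂ κ₃ κ₄ K M δ ≤ fBound α₁ K M δ) ∧
            (∀ M, M₀ ≤ M → ∀ ν ∈ Set.Icc lo hi, hExact K M ν ≤ hBound α₂ K M ν)) := by
  refine ⟨fun K M hKM S t c => ⟨System.nu_eq_sum hKM t c, (System.nu_mem hKM t c).1,
    (System.nu_mem hKM t c).2⟩, kappa, kappa, kappa, kappa, ?_⟩
  have hκ : 0 < kappa := by norm_num [kappa]
  refine ⟨hκ, hκ, hκ, hκ, fun K hK lo hi hlo _ => ?_⟩
  obtain ⟨g, hg0, hg1, hg, hgs, hg8⟩ := exists_phaseGap hK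
  have hK1 : (0 : ℝ) ≤ 2 * ((K : ℝ) - 1) := by
    have : (1 : ℝ) ≤ K := by exact_mod_cast hK
    linarith
  obtain ⟨M₀, hM₀⟩ := eventually_atTop.mp
    ((eventually_one_sub_scriptE_le_fBound hK hg0 hg1 hg).and
      ((eventually_mul_exp_le_hBound hK hK1 (by linarith : g / 16 < g / 2) hlo).and
      ((eventually_scriptE_le hK hg0 hg1 hg hlo).and
      ((eventually_all.mpr fun h : K = 1 ∨ K = 2 ∨ K = 4 ∨ 8 ≤ K =>
        eventually_hExact_le h hg0 hg1 hg8 hlo).and (eventually_ge_atTop 2)))))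
  have h2 : 2 ≤ M₀ := (hM₀ M₀ le_rfl).2.2.2.2
  have hα₁ : kappa * g / 8 ≤ g / 1000 := by rw [kappa]; linarith
  have hL : ∀ M, M₀ ≤ M → 0 < Real.log ((K : ℝ) * M) := fun M hM => by
    refine Real.log_pos ?_
    have : 1 < K * M := by nlinarith
    exact_mod_cast this
  refine ⟨lowerRate g lo, kappa * g / 8, g / 16, lowerRate_pos hg0 hlo, by positivity,
    by positivity, M₀, ⟨fBound (g / 1000) K, hBound (g / 16) K, ?_, ?_, ?_⟩, ?_, ?_⟩
  · refine upperBoundsPsi_of_scriptE hK h2 (fun M _ δ hδ => fBound_nonneg _ K M hδ.1)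
      (fun M _ ν _ => hBound_nonneg _ K M ν) (fun δ hδ => tendsto_fBound hK (by positivity) hδ.1)
      (fun ν hν => tendsto_hBound hK (by positivity) hlo fun M => (hν M).1)
      (fun M hM => (hM₀ M hM).1) fun M hM ν hν => ?_
    refine (one_sub_scriptE_le_one_add hK (by omega : 1 ≤ M)
      (mul_pos (hlo.trans_le hν.1) (hL M hM)) hg).trans (add_le_add_right ?_ _)
    refine (le_of_eq ?_).trans ((hM₀ M hM).2.1 ν hν.1)
    congr 2
    ring
  · exact fun M hM δ hδ => fBound_anti hα₁ hK (by omega) hδ.1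
  · exact fun M hM ν _ => le_rfl
  · intro M hM S hSlo _ t c δ hδ
    have hKM : 1 < K * M := by nlinarith
    split_ifs with hlt
    · rw [System.psi_succ hKM]
      have hν := (S.nu_mem hKM t c).1
      rw [hSlo] at hν
      linarith [(hM₀ M hM).2.2.1 δ hδ _ hν hlt]
    · exact (System.psi_mem hKM (t + 1) c).1
  · rintro ⟨m, hm⟩
    have hcases := two_pow_cases hm
    have hfle := fun (M : ℕ) (hM : 1 ≤ M) (δ : ℝ) (hδ : 0 < δ) =>
      fBound_le_fExact hcases hM hgs hg8 hδ
    have hh := fun (M : ℕ) (hM : M₀ ≤ M) => (hM₀ M hM).2.2.2.1 hcases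
    refine ⟨upperBoundsPsi_of_scriptE hK h2 (fun M hM δ hδ =>
        (fBound_nonneg _ K M hδ.1).trans (hfle M (by omega) δ hδ.1))
      (fun M hM ν _ => hExact_nonneg hcases (by omega) ν) (fun δ hδ => ?_) (fun ν hν => ?_)
      (fun M hM δ hδ ν hν => ((hM₀ M hM).1 δ hδ ν hν).trans (hfle M (by omega) δ hδ.1))
      (fun M hM ν hν => one_sub_scriptE_le_hExact hm (by omega) (hlo.trans_le hν.1)),
      fun δ hδ => eventually_fExact_le hcases hg0 hg1 hg8 hδ.1 hδ.2,
      fun M hM ν hν => hh M hM ν hν.1⟩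
    · refine squeeze_zero' ?_ (eventually_fExact_le hcases hg0 hg1 hg8 hδ.1 hδ.2)
        (tendsto_fBound hK (by positivity) hδ.1)
      filter_upwards [eventually_ge_atTop 1] with M hM
      exact (fBound_nonneg _ K M hδ.1).trans (hfle M hM δ hδ.1)
    · refine squeeze_zero' ?_ ?_
        (tendsto_hBound hK (by positivity : 0 < g / 16) hlo fun M => (hν M).1)
      · filter_upwards [eventually_ge_atTop 1] with M hM
        exact hExact_nonneg hcases hM _
      · filter_upwards [eventually_ge_atTop M₀] with M hM
        exact hh M hM _ (hν M).1
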